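/- Let $n>2$ be an integer, let $k$ be an odd integer with $1\le k\le n$, and put $$c_{n,k}=\frac1n\binom nk,\qquad b=\frac{2k}{k+1},\qquad \delta=\frac{n(k+1)-2k}{2k},\qquad q^*(k)=\begin{cases}\dfrac{(n+2)k}{n-2k}, & 1\le k<\frac n2,\\[1ex] \infty, & \frac n2\le k\le n.\end{cases}$$ Let $\kappa,q\in\mathbb R$ with $0<\kappa<n$ and $k<q<q^*(k)$. For $\gamma>0$, a solution of the problem $$(s^{\delta}(\theta')^k)'+s^{\delta}\bigl(bs\theta'+\kappa\theta+c_{n,k}^{-1}|\theta|^{q-1}\theta\bigr)=0\ \text{ in }(0,\infty),\qquad \theta(0)=\gamma,\quad \theta'(0)=0, \tag{P}$$ is a function $\theta\in C^1([0,\infty))$ such that $s^{\delta}(\theta')^k$ is differentiable on $(0,\infty)$ and (P) holds. Then there exists $\gamma>0$ such that (P) has a unique solution $\theta=\theta(\cdot,\gamma)$, and this solution satisfies $\theta(s)\ge 0$ for all $s\ge 0$ and $$\tilde L(\gamma):=\lim_{s\to\infty}s^{\kappa/b}\,\theta(s)=0 .$$ If moreover $k>1$, then this $\theta$ has compact support in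 $[0,\infty)$. -/

import Mathlib

open Set Filter Topology

namespace KHessianProfile

/-- The constant `c_{n,k} = (1/n) * binom(n,k)` of the radial `k`-Hessian operator. -/
noncomputable def c (n k : ℕ) : ℝ := (n.choose k : ℝ) / n

/-- The exponent `b = 2k/(k+1)` of the change of variables `s = b⁻¹ r^b`. -/
noncomputable def b (k : ℕ) : ℝ := 2 * (k : ℝ) / (k + 1)

/-- The common power `δ = (n(k+1) - 2k)/(2k)`. -/
noncomputable def δ (n k : ℕ) : ℝ := ((n : ℝ) * (k + 1) - 2 * k) / (2 * k)

/-- The Tso critical exponent: `(n+2)k/(n-2k)` if `k < n/2`, and `∞` if `n/2 ≤ k`. -/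
noncomputable def qStar (n k : ℕ) : EReal :=
  if 2 * k < n then ((((n : ℝ) + 2) * k / ((n : ℝ) - 2 * k) : ℝ) : EReal) else ⊤

/-- `θ` is a global solution, on `[0,∞)`, of
`(s^δ (θ')^k)' + s^δ (b s θ' + κ θ + c_{n,k}⁻¹ |θ|^(q-1) θ) = 0` for `s > 0`,
`θ(0) = γ`, `θ'(0) = 0`, with `θ` of class `C¹` on `[0,∞)` and `s^δ (θ')^k` differentiable on
`(0,∞)` (its derivative is then continuous, by the equation).
Only the values of `θ` on `[0,∞)` matter. -/
structure IsSolution (n k : ℕ) (κ q γ : ℝ) (θ : ℝ → ℝ) : Prop where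
  contDiffOn : ContDiffOn ℝ 1 θ (Ici 0)
  ode : ∀ s : ℝ, 0 < s →
    HasDerivAt (fun t : ℝ => t ^ δ n k * (deriv θ t) ^ k)
      (-(s ^ δ n k *
        (b k * s * deriv θ s + κ * θ s + (c n k)⁻¹ * (|θ s| ^ (q - 1) * θ s)))) s
  init_value : θ 0 = γ
  init_deriv : derivWithin θ (Ici 0) 0 = 0

end KHessianProfile

/-!
The solution is found by shooting in a one-parameter family. Put `a = c_{n,k}⁻¹`. If
`θ(s) = γ φ(r s)` with `γ^k r^(k+1) = γ^q`, the problem for `θ` becomes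
`(t^δ (φ')^k)' + t^δ (ε (b t φ' + κ φ) + a |φ|^(q-1) φ) = 0`, `φ(0) = 1`, `φ'(0) = 0`, with
`ε = γ^(1-q)`. Large heights `γ` correspond to small `ε`, and `ε = 0` is the Emden–Fowler limit,
which is therefore part of the family.

*Well-posedness.* While `φ > 0` the speed `v = -φ'` is positive, and `h = v^k / t` solves
`h(t) = ∫₀¹ σ^δ src(σ t) dσ`, where `src = ε κ φ + a φ^q - ε b t v`. This unknown stays away from
zero at `t = 0`, and with `h` cut off below at a level `m > 0` the equation becomes globally
Lipschitz (`truncOp_contraction`). Existence, uniqueness and continuity in `ε` for positive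
solutions (`Sol`) follow from the truncated equation; they hold as long as `h` is positive.

*Two open conditions.* Let `Crosses ε` mean that `φ` becomes negative, and `Trapped ε` that at some
time `v^k < ε b t φ` and `a φ^(q-1) < ε (b (δ + 1) - κ)`. Since
`(t^δ (ε b t φ - v^k))' = t^δ φ (ε (b (δ + 1) - κ) - a φ^(q-1))`, a trapped profile never reaches
zero. So the two conditions are disjoint (`not_crosses_and_trapped`) and open in `ε`. Because
`κ < n = b (δ + 1)`, large `ε` are trapped from the start (`exists_trapped`). Because `q` is
subcritical, `ε = 0` crosses (`crosses_zero`, by a Pohozaev identity and the decay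
`φ^(q-k) ≤ C t^(-k-1)`). By connectedness some critical `ε > 0` is neither (`exists_critical`).

*The critical profile.* It does not cross, and it tends to zero (`exists_phi_lt`). As it is not
trapped, eventually `v^k ≥ ε b t φ`. For `k = 1` this is `φ' ≤ -ε b t φ`, which gives decay faster
than any power (`tendsto_rpow_mul_phi`). For `k > 1` it makes `φ^(1-1/k)` decrease linearly, so the
life time of the positive solution is a finite interval `[0, S)` (`life_ne_Ici`); there `φ` and `v`
tend to zero, and extension by zero gives a global solution.

*Uniqueness.* A classical solution satisfies the same integral equation while positive, so it agrees
with the critical profile on `[0, S)` (`IsProfile.eqOn_life`). If `S` is finite it reaches zero with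
zero slope, and a nonincreasing energy keeps it there (`IsProfile.eq_zero_of_ge`).
-/

namespace KHessianProfile

/-! ### The rescaled family and its integral formulation -/

/-- The data of the equation
`(t^δ (φ')^k)' + t^δ (ε (b t φ' + κ φ) + a |φ|^(q-1) φ) = 0`
apart from the parameter `ε`. In the application `a = c_{n,k}⁻¹` and `n = b (δ + 1)`, so that
`δ + 1` plays the role of a dimension for a `(k+1)`-Laplacian; `subcritical` is then the condition
`q < q*(k)`, without division. -/
structure Params where
  k : ℕ
  δ : ℝ
  b : ℝ
  κ : ℝ
  q : ℝ
  a : ℝ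
  k_odd : Odd k
  δ_pos : 0 < δ
  b_pos : 0 < b
  κ_pos : 0 < κ
  κ_lt : κ < b * (δ + 1)
  a_pos : 0 < a
  k_lt_q : (k : ℝ) < q
  subcritical : (δ + 1) * (q - k) < (k + 1) * (q + 1)

/-- Truncation of a real number to `[0, 1]`. -/
noncomputable def clamp (x : ℝ) : ℝ := max 0 (min x 1)

lemma clamp_nonneg (x : ℝ) : 0 ≤ clamp x := le_max_left _ _

lemma clamp_le_one (x : ℝ) : clamp x ≤ 1 := max_le zero_le_one (min_le_right _ _)

lemma clamp_of_mem {x : ℝ} (h0 : 0 ≤ x) (h1 : x ≤ 1) : clamp x = x := by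
  rw [clamp, min_eq_left h1, max_eq_right h0]

lemma clamp_mono : Monotone clamp := fun _ _ h => max_le_max le_rfl (min_le_min h le_rfl)

lemma continuous_clamp : Continuous clamp := by unfold clamp; fun_prop

lemma abs_clamp_sub_le (x y : ℝ) : |clamp x - clamp y| ≤ |x - y| := by
  unfold clamp
  refine (abs_max_sub_max_le_max _ _ _ _).trans ?_
  refine max_le (by simp) ((abs_min_sub_min_le_max _ _ _ _).trans (max_le le_rfl (by simp)))

/-- The position `1 - ∫₀ᵗ v` of a profile starting at height `1` and descending with speed `v`. -/
noncomputable def height (v : ℝ → ℝ) (t : ℝ) : ℝ := 1 - ∫ τ in (0 : ℝ)..t, v τ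

lemma hasDerivAt_height {v : ℝ → ℝ} (hv : Continuous v) (t : ℝ) :
    HasDerivAt (height v) (-v t) t :=
  (hv.integral_hasStrictDerivAt 0 t).hasDerivAt.const_sub 1

lemma continuous_height {v : ℝ → ℝ} (hv : Continuous v) : Continuous (height v) :=
  continuous_iff_continuousAt.2 fun t => (hasDerivAt_height hv t).continuousAt

@[simp] lemma height_zero (v : ℝ → ℝ) : height v 0 = 1 := by simp [height]

lemma height_congr {v w : ℝ → ℝ} {t : ℝ} (ht : 0 ≤ t)
    (h : EqOn v w (Icc 0 t)) : height v t = height w t := by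
  rw [height, height, intervalIntegral.integral_congr (g := w)]
  rwa [uIcc_of_le ht]

lemma height_antitone {v : ℝ → ℝ} (hv : Continuous v) (h : ∀ t, 0 ≤ v t) :
    Antitone (height v) :=
  antitone_of_hasDerivAt_nonpos (hasDerivAt_height hv) fun t => neg_nonpos.2 (h t)

namespace Params

variable (D : Params)

lemma k_ne_zero : D.k ≠ 0 := by
  rintro h
  have := D.k_odd
  simp [h] at this

lemma one_le_k : (1 : ℝ) ≤ D.k := by exact_mod_cast Nat.one_le_iff_ne_zero.2 D.k_ne_zero

lemma k_pos : (0 : ℝ) < D.k := one_pos.trans_le D.one_le_k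

lemma one_lt_q : 1 < D.q := D.one_le_k.trans_lt D.k_lt_q

/-- The `k`-th root of the positive part. -/
noncomputable def rt (x : ℝ) : ℝ := (max x 0) ^ ((D.k : ℝ)⁻¹)

lemma rt_nonneg (x : ℝ) : 0 ≤ D.rt x := Real.rpow_nonneg (le_max_right _ _) _

lemma rt_pow {x : ℝ} (hx : 0 ≤ x) : D.rt x ^ D.k = x := by
  rw [rt, max_eq_left hx, Real.rpow_inv_natCast_pow hx D.k_ne_zero]

lemma rt_of_pow {x : ℝ} (hx : 0 ≤ x) : D.rt (x ^ D.k) = x := by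
  rw [rt, max_eq_left (by positivity), Real.pow_rpow_inv_natCast hx D.k_ne_zero]

lemma rt_of_nonpos {x : ℝ} (hx : x ≤ 0) : D.rt x = 0 := by
  rw [rt, max_eq_right hx, Real.zero_rpow (inv_ne_zero D.k_pos.ne')]

lemma rt_pos {x : ℝ} (hx : 0 < x) : 0 < D.rt x := by
  rw [rt, max_eq_left hx.le]; positivity

lemma rt_mono : Monotone D.rt := fun _ _ h =>
  Real.rpow_le_rpow (le_max_right _ _) (max_le_max h le_rfl) (inv_nonneg.2 D.k_pos.le)

lemma continuous_rt : Continuous D.rt := by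
  unfold rt
  exact (continuous_id.max continuous_const).rpow_const fun _ => Or.inr (inv_nonneg.2 D.k_pos.le)

lemma rt_mul {x y : ℝ} (hx : 0 ≤ x) (hy : 0 ≤ y) : D.rt (x * y) = D.rt x * D.rt y := by
  rw [rt, rt, rt, max_eq_left hx, max_eq_left hy, max_eq_left (mul_nonneg hx hy),
    Real.mul_rpow hx hy]

/-- Away from zero the root is Lipschitz. -/
lemma abs_rt_sub_rt_le {m x y : ℝ} (hm : 0 < m) (hx : m ≤ x) (hy : m ≤ y) :
    |D.rt x - D.rt y| ≤ (D.rt m ^ (D.k - 1))⁻¹ * |x - y| := by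
  wlog hxy : y ≤ x generalizing x y
  · rw [abs_sub_comm, abs_sub_comm x]
    exact this hy hx (le_of_not_ge hxy)
  have hr := D.rt_pos hm
  rw [abs_of_nonneg (sub_nonneg.2 hxy), abs_of_nonneg (sub_nonneg.2 (D.rt_mono hxy)),
    inv_mul_eq_div, le_div_iff₀ (by positivity)]
  have h1 : D.rt m ≤ D.rt y := D.rt_mono hy
  have h2 : D.rt y ≤ D.rt x := D.rt_mono hxy
  have h3 : D.rt m ^ (D.k - 1) ≤ D.rt y ^ (D.k - 1) := pow_le_pow_left₀ hr.le h1 _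
  have h4 : D.rt y ^ (D.k - 1) ≤ D.rt x ^ (D.k - 1) := pow_le_pow_left₀ (hr.le.trans h1) h2 _
  have hk : D.k - 1 + 1 = D.k := Nat.succ_pred_eq_of_ne_zero D.k_ne_zero
  have e1 : D.rt x ^ (D.k - 1) * D.rt x = x := by
    rw [← pow_succ, hk, D.rt_pow (by linarith)]
  have e2 : D.rt y ^ (D.k - 1) * D.rt y = y := by
    rw [← pow_succ, hk, D.rt_pow (by linarith)]
  calc (D.rt x - D.rt y) * D.rt m ^ (D.k - 1) ≤ (D.rt x - D.rt y) * D.rt y ^ (D.k - 1) :=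
        mul_le_mul_of_nonneg_left h3 (sub_nonneg.2 h2)
    _ = D.rt y ^ (D.k - 1) * D.rt x - y := by rw [sub_mul, mul_comm, mul_comm (D.rt y), e2]
    _ ≤ D.rt x ^ (D.k - 1) * D.rt x - y :=
        sub_le_sub_right (mul_le_mul_of_nonneg_right h4 (D.rt_nonneg _)) _
    _ = x - y := by rw [e1]

/-- The zeroth order terms `ε κ x + a x^q`, truncated to `x ∈ [0, 1]` to be globally Lipschitz. -/
noncomputable def react (ε x : ℝ) : ℝ := ε * D.κ * clamp x + D.a * clamp x ^ D.q

lemma continuous_react (ε : ℝ) : Continuous (D.react ε) := by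
  unfold react
  exact (continuous_const.mul continuous_clamp).add (continuous_const.mul
    (continuous_clamp.rpow_const fun _ => Or.inr (by linarith [D.one_lt_q])))

lemma react_of_mem {ε x : ℝ} (h0 : 0 ≤ x) (h1 : x ≤ 1) :
    D.react ε x = ε * D.κ * x + D.a * x ^ D.q := by rw [react, clamp_of_mem h0 h1]

lemma react_mono {ε : ℝ} (hε : 0 ≤ ε) : Monotone (D.react ε) := fun x y h => by
  have := D.κ_pos
  have := D.a_pos
  have := D.one_lt_q
  unfold react
  gcongr
  · exact clamp_mono h
  · exact clamp_nonneg x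
  · exact clamp_mono h

lemma react_nonneg {ε : ℝ} (hε : 0 ≤ ε) (x : ℝ) : 0 ≤ D.react ε x := by
  have := D.κ_pos
  have := D.a_pos
  have := clamp_nonneg x
  unfold react
  positivity

lemma react_pos {ε x : ℝ} (hε : 0 ≤ ε) (hx : 0 < x) : 0 < D.react ε x := by
  have := D.κ_pos
  have := D.a_pos
  have : 0 < clamp x := lt_max_of_lt_right (lt_min hx one_pos)
  unfold react
  positivity

lemma react_le {ε : ℝ} (hε : 0 ≤ ε) (x : ℝ) : D.react ε x ≤ ε * D.κ + D.a := by
  have hκ := D.κ_pos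
  have ha := D.a_pos
  have h0 := clamp_nonneg x
  have h1 := clamp_le_one x
  have h2 : clamp x ^ D.q ≤ 1 := Real.rpow_le_one h0 h1 (by linarith [D.one_lt_q])
  unfold react
  have : ε * D.κ * clamp x ≤ ε * D.κ * 1 := by gcongr
  have : D.a * clamp x ^ D.q ≤ D.a * 1 := by gcongr
  linarith

lemma abs_rpow_sub_le {x y : ℝ} (hx : x ∈ Icc (0 : ℝ) 1) (hy : y ∈ Icc (0 : ℝ) 1) :
    |x ^ D.q - y ^ D.q| ≤ D.q * |x - y| := by
  have hq := D.one_lt_q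
  refine Convex.norm_image_sub_le_of_norm_hasDerivWithin_le (f := fun x : ℝ => x ^ D.q)
    (f' := fun x => D.q * x ^ (D.q - 1)) (s := Icc 0 1)
    (fun z _ => (Real.hasDerivAt_rpow_const (Or.inr hq.le)).hasDerivWithinAt) ?_
    (convex_Icc 0 1) hy hx
  intro z hz
  have h1 : z ^ (D.q - 1) ≤ 1 := Real.rpow_le_one hz.1 hz.2 (by linarith)
  have h0 : 0 ≤ z ^ (D.q - 1) := Real.rpow_nonneg hz.1 _
  rw [Real.norm_of_nonneg (by positivity)]
  nlinarith

lemma abs_react_sub_le {R ε : ℝ} (hε : |ε| ≤ R) (x y : ℝ) :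
    |D.react ε x - D.react ε y| ≤ (R * D.κ + D.a * D.q) * |x - y| := by
  have h1 := abs_clamp_sub_le x y
  have h2 := D.abs_rpow_sub_le ⟨clamp_nonneg x, clamp_le_one x⟩ ⟨clamp_nonneg y, clamp_le_one y⟩
  have hκ := D.κ_pos
  have ha := D.a_pos
  have hq := D.one_lt_q
  have hR : 0 ≤ R := (abs_nonneg _).trans hε
  have e : D.react ε x - D.react ε y = ε * D.κ * (clamp x - clamp y)
      + D.a * (clamp x ^ D.q - clamp y ^ D.q) := by unfold react; ring
  rw [e]
  refine (abs_add_le _ _).trans ?_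
  rw [abs_mul, abs_mul, abs_mul, abs_of_pos hκ, abs_of_pos ha, add_mul]
  have h3 : D.a * |clamp x ^ D.q - clamp y ^ D.q| ≤ D.a * (D.q * |x - y|) := by
    gcongr
    exact h2.trans (by gcongr)
  have h4 : |ε| * D.κ * |clamp x - clamp y| ≤ R * D.κ * |x - y| := by gcongr
  linarith

/-- The weighted mean `∫₀¹ σ^δ f(σ t) dσ`, which equals `t^(-δ-1) ∫₀ᵗ τ^δ f(τ) dτ` for `t > 0` but
is visibly continuous up to `t = 0`. -/
noncomputable def avg (f : ℝ → ℝ) (t : ℝ) : ℝ := ∫ σ in (0 : ℝ)..1, σ ^ D.δ * f (σ * t)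

lemma continuous_rpow_δ : Continuous fun t : ℝ => t ^ D.δ :=
  continuous_id.rpow_const fun _ => Or.inr D.δ_pos.le

lemma continuous_avg {f : ℝ → ℝ} (hf : Continuous f) : Continuous (D.avg f) := by
  unfold avg
  apply intervalIntegral.continuous_parametric_intervalIntegral_of_continuous'
  exact (D.continuous_rpow_δ.comp continuous_snd).mul
    (hf.comp (continuous_snd.mul continuous_fst))

lemma mul_mem_Icc {σ t : ℝ} (hσ : σ ∈ Icc (0 : ℝ) 1) (ht : 0 ≤ t) : σ * t ∈ Icc 0 t :=
  ⟨mul_nonneg hσ.1 ht, mul_le_of_le_one_left ht hσ.2⟩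

lemma avg_congr {f g : ℝ → ℝ} {t : ℝ} (ht : 0 ≤ t) (h : EqOn f g (Icc 0 t)) :
    D.avg f t = D.avg g t := by
  refine intervalIntegral.integral_congr fun σ hσ => ?_
  rw [uIcc_of_le zero_le_one] at hσ
  simp only [h (mul_mem_Icc hσ ht)]

lemma integral_rpow_δ (t : ℝ) :
    ∫ σ in (0 : ℝ)..t, σ ^ D.δ = t ^ (D.δ + 1) / (D.δ + 1) := by
  have := D.δ_pos
  rw [integral_rpow (Or.inl (by linarith)), Real.zero_rpow (by linarith), sub_zero]

lemma avg_zero (f : ℝ → ℝ) : D.avg f 0 = f 0 / (D.δ + 1) := by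
  have := D.integral_rpow_δ 1
  simp only [avg, mul_zero, intervalIntegral.integral_mul_const, this, Real.one_rpow]
  ring

/-- The weighted primitive `∫₀ᵗ τ^δ f(τ) dτ`. -/
noncomputable def prim (f : ℝ → ℝ) (t : ℝ) : ℝ := ∫ τ in (0 : ℝ)..t, τ ^ D.δ * f τ

lemma hasDerivAt_prim {f : ℝ → ℝ} (hf : Continuous f) (t : ℝ) :
    HasDerivAt (D.prim f) (t ^ D.δ * f t) t :=
  ((D.continuous_rpow_δ.mul hf).integral_hasStrictDerivAt 0 t).hasDerivAt

@[simp] lemma prim_zero (f : ℝ → ℝ) : D.prim f 0 = 0 := by simp [prim]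

lemma rpow_mul_avg (f : ℝ → ℝ) {t : ℝ} (ht : 0 ≤ t) :
    t ^ (D.δ + 1) * D.avg f t = D.prim f t := by
  have hδ := D.δ_pos
  rcases ht.eq_or_lt with rfl | ht
  · rw [Real.zero_rpow (by linarith)]; simp
  have h := intervalIntegral.integral_comp_mul_right (a := 0) (b := 1)
    (fun τ : ℝ => τ ^ D.δ * f τ) ht.ne'
  simp only [zero_mul, one_mul, smul_eq_mul] at h
  have h2 : ∫ σ in (0 : ℝ)..1, (σ * t) ^ D.δ * f (σ * t) = t ^ D.δ * D.avg f t := by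
    rw [avg, ← intervalIntegral.integral_const_mul]
    refine intervalIntegral.integral_congr fun σ hσ => ?_
    rw [uIcc_of_le zero_le_one] at hσ
    simp only [Real.mul_rpow hσ.1 ht.le]
    ring
  rw [h2] at h
  rw [Real.rpow_add_one ht.ne', prim]
  calc t ^ D.δ * t * D.avg f t = t * (t ^ D.δ * D.avg f t) := by ring
    _ = _ := by rw [h]; field_simp

lemma abs_avg_le {f : ℝ → ℝ} {t C : ℝ} (ht : 0 ≤ t)
    (h : ∀ s ∈ Icc 0 t, |f s| ≤ C) : |D.avg f t| ≤ C := by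
  have := intervalIntegral.norm_integral_le_of_norm_le_const (a := 0) (b := 1) (C := C)
    (f := fun σ : ℝ => σ ^ D.δ * f (σ * t)) ?_
  · rwa [sub_zero, abs_one, mul_one] at this
  intro σ hσ
  rw [uIoc_of_le zero_le_one] at hσ
  have h1 : σ ^ D.δ ≤ 1 := Real.rpow_le_one hσ.1.le hσ.2 D.δ_pos.le
  have h0 : 0 ≤ σ ^ D.δ := Real.rpow_nonneg hσ.1.le _
  rw [norm_mul, Real.norm_of_nonneg h0, Real.norm_eq_abs]
  calc σ ^ D.δ * |f (σ * t)| ≤ 1 * |f (σ * t)| := by gcongr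
    _ ≤ C := by rw [one_mul]; exact h _ (mul_mem_Icc ⟨hσ.1.le, hσ.2⟩ ht)

lemma avg_sub {f g : ℝ → ℝ} (hf : Continuous f) (hg : Continuous g) (t : ℝ) :
    D.avg f t - D.avg g t = D.avg (fun s => f s - g s) t := by
  have hint : ∀ {f : ℝ → ℝ}, Continuous f →
      IntervalIntegrable (fun σ : ℝ => σ ^ D.δ * f (σ * t)) MeasureTheory.volume 0 1 :=
    fun hf => (D.continuous_rpow_δ.mul (hf.comp (continuous_id.mul continuous_const))
      ).intervalIntegrable _ _
  rw [avg, avg, ← intervalIntegral.integral_sub (hint hf) (hint hg)]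
  simp only [avg, mul_sub]

/-- The source `ε κ φ + a φ^q - ε b t v` with `φ = height v`: for a decreasing solution,
`(t^δ v^k)' = t^δ src`. -/
noncomputable def src (ε : ℝ) (v : ℝ → ℝ) (t : ℝ) : ℝ := D.react ε (height v t) - ε * D.b * t * v t

lemma continuous_src (ε : ℝ) {v : ℝ → ℝ} (hv : Continuous v) : Continuous (D.src ε v) :=
  ((D.continuous_react ε).comp (continuous_height hv)).sub
    ((continuous_const.mul continuous_id).mul hv)

lemma src_congr (ε : ℝ) {v w : ℝ → ℝ} {t : ℝ} (h : EqOn v w (Icc 0 t)) :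
    EqOn (D.src ε v) (D.src ε w) (Icc 0 t) := fun s hs => by
  rw [src, src, h hs, height_congr hs.1 (h.mono (Icc_subset_Icc_right hs.2))]

/-- The speed `v = (t h)^(1/k)` recovered from the unknown `h = v^k / t`, which unlike `v` stays
away from zero near `t = 0`. -/
noncomputable def vel (h : ℝ → ℝ) (t : ℝ) : ℝ := D.rt (t * h t)

lemma continuous_vel {h : ℝ → ℝ} (hh : Continuous h) : Continuous (D.vel h) :=
  D.continuous_rt.comp (continuous_id.mul hh)

lemma vel_nonneg (h : ℝ → ℝ) (t : ℝ) : 0 ≤ D.vel h t := D.rt_nonneg _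

/-- `h` solves the integral equation `h = avg (src ε (vel h))` on `[0, T]` and is positive there.
The values of `h` outside `[0, T]` are irrelevant; `h` is continuous on `ℝ` for convenience. -/
structure Sol (ε T : ℝ) (h : ℝ → ℝ) : Prop where
  cont : Continuous h
  pos : ∀ t ∈ Icc 0 T, 0 < h t
  eq : ∀ t ∈ Icc 0 T, h t = D.avg (D.src ε (D.vel h)) t

/-- The operator of the integral equation with the unknown cut off below at the level `m`. -/
noncomputable def truncOp (ε m : ℝ) (h : ℝ → ℝ) : ℝ → ℝ :=
  D.avg (D.src ε (D.vel fun s => max (h s) m))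

/-- Solutions on `[0, T]` of the integral equation with the unknown cut off below at `m`. -/
structure Trunc (ε m T : ℝ) (h : ℝ → ℝ) : Prop where
  cont : Continuous h
  eq : ∀ t ∈ Icc 0 T, h t = D.truncOp ε m h t

variable {D}

lemma Sol.mono {ε T T' : ℝ} {h : ℝ → ℝ} (hs : D.Sol ε T h) (hT : T' ≤ T) : D.Sol ε T' h :=
  ⟨hs.cont, fun t ht => hs.pos t ⟨ht.1, ht.2.trans hT⟩, fun t ht => hs.eq t ⟨ht.1, ht.2.trans hT⟩⟩

lemma Trunc.mono {ε m T T' : ℝ} {h : ℝ → ℝ} (hs : D.Trunc ε m T h) (hT : T' ≤ T) :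
    D.Trunc ε m T' h :=
  ⟨hs.cont, fun t ht => hs.eq t ⟨ht.1, ht.2.trans hT⟩⟩

lemma vel_congr {h g : ℝ → ℝ} {s : Set ℝ} (e : EqOn h g s) : EqOn (D.vel h) (D.vel g) s :=
  fun t ht => by rw [vel, vel, e ht]

lemma truncOp_eq {ε m t : ℝ} {h : ℝ → ℝ} (ht : 0 ≤ t) (hm : ∀ s ∈ Icc 0 t, m ≤ h s) :
    D.truncOp ε m h t = D.avg (D.src ε (D.vel h)) t :=
  D.avg_congr ht (D.src_congr ε (vel_congr fun s hs => max_eq_left (hm s hs)))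

lemma Sol.trunc {ε m T : ℝ} {h : ℝ → ℝ} (hs : D.Sol ε T h) (hm : ∀ t ∈ Icc 0 T, m ≤ h t) :
    D.Trunc ε m T h :=
  ⟨hs.cont, fun t ht => by
    rw [truncOp_eq ht.1 fun s hs => hm s ⟨hs.1, hs.2.trans ht.2⟩, hs.eq t ht]⟩

lemma Trunc.sol {ε m T : ℝ} {h : ℝ → ℝ} (hs : D.Trunc ε m T h) (hm0 : 0 < m)
    (hm : ∀ t ∈ Icc 0 T, m ≤ h t) : D.Sol ε T h :=
  ⟨hs.cont, fun t ht => hm0.trans_le (hm t ht), fun t ht => by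
    rw [← truncOp_eq ht.1 fun s hs => hm s ⟨hs.1, hs.2.trans ht.2⟩, hs.eq t ht]⟩

/-! ### Well-posedness of the truncated integral equation -/

lemma continuous_max_const {h : ℝ → ℝ} (hh : Continuous h) (m : ℝ) :
    Continuous fun s => max (h s) m := hh.max continuous_const

lemma continuous_truncOp {ε m : ℝ} {h : ℝ → ℝ} (hh : Continuous h) :
    Continuous (D.truncOp ε m h) :=
  D.continuous_avg (D.continuous_src ε (D.continuous_vel (continuous_max_const hh m)))

variable (D) in
/-- A Lipschitz constant on `[0, T]` for the speed as a function of the unknown cut off at `m`. -/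
noncomputable def velLip (m T : ℝ) : ℝ := D.rt T * (D.rt m ^ (D.k - 1))⁻¹

lemma velLip_nonneg (m T : ℝ) : 0 ≤ D.velLip m T :=
  mul_nonneg (D.rt_nonneg _) (inv_nonneg.2 (pow_nonneg (D.rt_nonneg _) _))

lemma abs_vel_sub_le {m T t : ℝ} (hm : 0 < m) (ht : t ∈ Icc 0 T) (h₁ h₂ : ℝ → ℝ) :
    |D.vel (fun s => max (h₁ s) m) t - D.vel (fun s => max (h₂ s) m) t|
      ≤ D.velLip m T * |h₁ t - h₂ t| := by
  have p1 : 0 ≤ max (h₁ t) m := hm.le.trans (le_max_right _ _)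
  have p2 : 0 ≤ max (h₂ t) m := hm.le.trans (le_max_right _ _)
  have h3 := D.abs_rt_sub_rt_le hm (le_max_right (h₁ t) m) (le_max_right (h₂ t) m)
  have h4 : |max (h₁ t) m - max (h₂ t) m| ≤ |h₁ t - h₂ t| :=
    (abs_max_sub_max_le_max _ _ _ _).trans (by simp)
  have h5 : 0 ≤ (D.rt m ^ (D.k - 1))⁻¹ := inv_nonneg.2 (pow_nonneg (D.rt_nonneg _) _)
  have h6 : D.rt t ≤ D.rt T := D.rt_mono ht.2
  simp only [vel]
  rw [D.rt_mul ht.1 p1, D.rt_mul ht.1 p2, ← mul_sub, abs_mul, abs_of_nonneg (D.rt_nonneg t),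
    velLip, mul_assoc]
  exact mul_le_mul h6 (h3.trans (by gcongr)) (abs_nonneg _) (D.rt_nonneg _)

lemma abs_height_sub_le {v w : ℝ → ℝ} (hv : Continuous v) (hw : Continuous w) {t C : ℝ}
    (ht : 0 ≤ t) (h : ∀ s ∈ Icc 0 t, |v s - w s| ≤ C) :
    |height v t - height w t| ≤ C * t := by
  have e : height v t - height w t
      = -∫ s in (0 : ℝ)..t, (v s - w s) := by
    rw [intervalIntegral.integral_sub (hv.intervalIntegrable _ _) (hw.intervalIntegrable _ _)]
    simp only [height]
    ring
  rw [e, abs_neg]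
  have := intervalIntegral.norm_integral_le_of_norm_le_const (a := 0) (b := t) (C := C)
    (f := fun s => v s - w s) fun s hs => by
      rw [uIoc_of_le ht] at hs
      exact h s ⟨hs.1.le, hs.2⟩
  rwa [sub_zero, abs_of_nonneg ht] at this

lemma exp_mul_mono {K s t : ℝ} (hK : 0 < K) (h : s ≤ t) : Real.exp (K * s) ≤ Real.exp (K * t) :=
  Real.exp_le_exp.2 (mul_le_mul_of_nonneg_left h hK.le)

/-- In the norm `sup exp(-K t) |h t|` on `[0, T]` with `K` large, the operator is a contraction:
the differences of the sources carry a factor `t`, and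
`∫₀¹ t exp(K σ t) dσ ≤ exp(K t) / K`. -/
lemma truncOp_contraction (D : Params) {m T R : ℝ} (hm : 0 < m) (hR : 0 ≤ R) :
    ∃ K : ℝ, 0 < K ∧ ∀ ε, |ε| ≤ R → ∀ h₁ h₂ : ℝ → ℝ, Continuous h₁ → Continuous h₂ →
      ∀ d, 0 ≤ d → ∀ t ∈ Icc 0 T,
      (∀ s ∈ Icc 0 t, |h₁ s - h₂ s| ≤ d * Real.exp (K * s)) →
      |D.truncOp ε m h₁ t - D.truncOp ε m h₂ t| ≤ d / 2 * Real.exp (K * t) := by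
  have hκ := D.κ_pos
  have ha := D.a_pos
  have hb := D.b_pos
  have hq := D.one_lt_q
  set L := D.velLip m T with hLdef
  have hL : 0 ≤ L := velLip_nonneg m T
  set C := (R * D.κ + D.a * D.q) * L + R * D.b * L with hC
  have hC0 : 0 ≤ C := by positivity
  refine ⟨2 * C + 1, by positivity, ?_⟩
  set K := 2 * C + 1 with hK
  have hK0 : 0 < K := by positivity
  intro ε hε h₁ h₂ c₁ c₂ d hd t ht hs
  set v₁ := D.vel fun s => max (h₁ s) m with hv₁
  set v₂ := D.vel fun s => max (h₂ s) m with hv₂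
  have cv₁ : Continuous v₁ := D.continuous_vel (continuous_max_const c₁ m)
  have cv₂ : Continuous v₂ := D.continuous_vel (continuous_max_const c₂ m)
  have hv : ∀ s ∈ Icc 0 t, |v₁ s - v₂ s| ≤ L * (d * Real.exp (K * s)) := fun s hs' =>
    (abs_vel_sub_le hm ⟨hs'.1, hs'.2.trans ht.2⟩ h₁ h₂).trans
      (mul_le_mul_of_nonneg_left (hs s hs') hL)
  have hheight : ∀ s ∈ Icc 0 t, |height v₁ s - height v₂ s|
      ≤ L * (d * Real.exp (K * s)) * s := fun s hs' => by
    refine abs_height_sub_le cv₁ cv₂ hs'.1 fun r hr => (hv r ⟨hr.1, hr.2.trans hs'.2⟩).trans ?_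
    have := exp_mul_mono hK0 hr.2
    gcongr
  have hsrc : ∀ s ∈ Icc 0 t, |D.src ε v₁ s - D.src ε v₂ s| ≤ C * d * s * Real.exp (K * s) := by
    intro s hs'
    have e : D.src ε v₁ s - D.src ε v₂ s
        = (D.react ε (height v₁ s) - D.react ε (height v₂ s))
          - ε * D.b * s * (v₁ s - v₂ s) := by simp only [src]; ring
    rw [e]
    refine (abs_sub _ _).trans ?_
    have h1 := (D.abs_react_sub_le hε (height v₁ s) (height v₂ s)).trans
      (mul_le_mul_of_nonneg_left (hheight s hs') (by positivity))
    have h2 : |ε * D.b * s * (v₁ s - v₂ s)| ≤ R * D.b * s * (L * (d * Real.exp (K * s))) := by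
      have hs0 := hs'.1
      rw [abs_mul, abs_mul, abs_mul, abs_of_pos hb, abs_of_nonneg hs0]
      have := hv s hs'
      gcongr
    calc _ ≤ _ := add_le_add h1 h2
      _ = C * d * s * Real.exp (K * s) := by rw [hC]; ring
  rw [truncOp, truncOp, D.avg_sub (D.continuous_src ε cv₁) (D.continuous_src ε cv₂), avg]
  have hderiv : ∀ σ ∈ uIcc (0 : ℝ) 1, HasDerivAt (fun σ => C * d / K * Real.exp (K * (σ * t)))
      (C * d * t * Real.exp (K * (σ * t))) σ := fun σ _ => by
    have h1 : HasDerivAt (fun σ : ℝ => K * (σ * t)) (K * t) σ := by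
      simpa using ((hasDerivAt_id σ).mul_const t).const_mul K
    refine (h1.exp.const_mul (C * d / K)).congr_deriv ?_
    field_simp
  have hcont : Continuous fun σ : ℝ => C * d * t * Real.exp (K * (σ * t)) := by fun_prop
  have hint := intervalIntegral.integral_eq_sub_of_hasDerivAt hderiv
    (hcont.intervalIntegrable _ _)
  have hle := intervalIntegral.norm_integral_le_of_norm_le (a := (0 : ℝ)) (b := 1)
    (f := fun σ : ℝ => σ ^ D.δ * (D.src ε v₁ (σ * t) - D.src ε v₂ (σ * t)))
    (g := fun σ => C * d * t * Real.exp (K * (σ * t))) (μ := MeasureTheory.volume) zero_le_one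
    (Filter.Eventually.of_forall fun σ hσ => by
      have h1 : σ ^ D.δ ≤ 1 := Real.rpow_le_one hσ.1.le hσ.2 D.δ_pos.le
      have h0 : 0 ≤ σ ^ D.δ := Real.rpow_nonneg hσ.1.le _
      have hmem := mul_mem_Icc ⟨hσ.1.le, hσ.2⟩ ht.1
      rw [norm_mul, Real.norm_of_nonneg h0, Real.norm_eq_abs]
      calc _ ≤ 1 * (C * d * (σ * t) * Real.exp (K * (σ * t))) :=
            mul_le_mul h1 (hsrc _ hmem) (abs_nonneg _) zero_le_one
        _ ≤ C * d * t * Real.exp (K * (σ * t)) := by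
            rw [one_mul]
            have := hmem.2
            gcongr) (hcont.intervalIntegrable _ _)
  rw [hint] at hle
  refine hle.trans ?_
  simp only [one_mul, zero_mul, mul_zero, Real.exp_zero, mul_one]
  have h3 : C * d / K ≤ d / 2 := by
    rw [div_le_div_iff₀ hK0 two_pos, hK]; nlinarith
  have h4 : 0 ≤ C * d / K := by positivity
  have := mul_le_mul_of_nonneg_right h3 (Real.exp_pos (K * t)).le
  linarith

/-- Existence for the truncated equation, by Banach's fixed point theorem for
`y t = exp(-K t) h t` in `C([0, T])`. -/
lemma exists_trunc (D : Params) (ε : ℝ) {m T : ℝ} (hm : 0 < m) (hT : 0 ≤ T) :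
    ∃ h, D.Trunc ε m T h := by
  obtain ⟨K, hK, hcontr⟩ := D.truncOp_contraction (T := T) hm (abs_nonneg ε)
  let ext : C(Icc 0 T, ℝ) → ℝ → ℝ := fun y t => Real.exp (K * t) * IccExtend hT y t
  have cext : ∀ y, Continuous (ext y) := fun y =>
    (by fun_prop : Continuous fun t => Real.exp (K * t)).mul y.continuous.Icc_extend'
  let Ψ : C(Icc 0 T, ℝ) → C(Icc 0 T, ℝ) := fun y =>
    ⟨fun t => Real.exp (-(K * t)) * D.truncOp ε m (ext y) t, by
      have := continuous_truncOp (D := D) (ε := ε) (m := m) (cext y)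
      fun_prop⟩
  have hΨ : ContractingWith (1 / 2 : NNReal) Ψ := by
    refine ⟨by rw [← NNReal.coe_lt_coe]; norm_num, LipschitzWith.of_dist_le_mul fun y z => ?_⟩
    have hd : 0 ≤ dist y z := dist_nonneg
    rw [ContinuousMap.dist_le (by positivity)]
    intro t
    have key := hcontr ε le_rfl (ext y) (ext z) (cext y) (cext z) (dist y z) hd t t.2 ?_
    · have e : dist (Ψ y t) (Ψ z t) = Real.exp (-(K * t)) *
          |D.truncOp ε m (ext y) t - D.truncOp ε m (ext z) t| := by
        rw [Real.dist_eq]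
        simp only [Ψ, ContinuousMap.coe_mk]
        rw [← mul_sub, abs_mul, abs_of_pos (Real.exp_pos _)]
      rw [e]
      calc _ ≤ Real.exp (-(K * t)) * (dist y z / 2 * Real.exp (K * t)) := by gcongr
        _ = (Real.exp (-(K * t)) * Real.exp (K * t)) * (dist y z / 2) := by ring
        _ = _ := by rw [← Real.exp_add, neg_add_cancel, Real.exp_zero]; push_cast; ring
    · intro s hs
      have hsT : s ∈ Icc 0 T := ⟨hs.1, hs.2.trans t.2.2⟩
      simp only [ext, IccExtend_of_mem hT _ hsT]
      rw [← mul_sub, abs_mul, abs_of_pos (Real.exp_pos _), mul_comm]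
      gcongr
      rw [← Real.dist_eq]
      exact ContinuousMap.dist_apply_le_dist _
  obtain ⟨y, hy⟩ : ∃ y, Ψ y = y := ⟨_, hΨ.fixedPoint_isFixedPt⟩
  refine ⟨ext y, cext y, fun t ht => ?_⟩
  have h1 : Ψ y ⟨t, ht⟩ = y ⟨t, ht⟩ := by rw [hy]
  simp only [ext, IccExtend_of_mem hT _ ht]
  rw [← h1]
  simp only [Ψ, ContinuousMap.coe_mk]
  rw [← mul_assoc, ← Real.exp_add, add_neg_cancel, Real.exp_zero, one_mul]

/-- Lipschitz dependence on the parameter for the truncated equation. -/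
lemma Trunc.stable {ε₀ m T : ℝ} {h₀ : ℝ → ℝ} (hm : 0 < m)
    (hs₀ : D.Trunc ε₀ m T h₀) (R : ℝ) : ∃ C, 0 ≤ C ∧ ∀ ε, |ε| ≤ R → ∀ h, D.Trunc ε m T h →
      ∀ t ∈ Icc 0 T, |h t - h₀ t| ≤ C * |ε - ε₀| := by
  rcases lt_or_ge T 0 with hT | hT
  · exact ⟨0, le_rfl, fun _ _ _ _ t ht => absurd (ht.1.trans ht.2) (not_le.2 hT)⟩
  rcases lt_or_ge R 0 with hR | hR
  · exact ⟨0, le_rfl, fun ε hε => absurd ((abs_nonneg _).trans hε) (not_le.2 hR)⟩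
  have hκ := D.κ_pos
  have hb := D.b_pos
  obtain ⟨K, hK, hcontr⟩ := D.truncOp_contraction (T := T) hm hR
  have cv : Continuous (D.vel fun s => max (h₀ s) m) :=
    D.continuous_vel (continuous_max_const hs₀.cont m)
  obtain ⟨V, hV⟩ := isCompact_Icc.exists_bound_of_continuousOn (s := Icc 0 T) cv.continuousOn
  have hV0 : 0 ≤ V := (norm_nonneg _).trans (hV 0 ⟨le_rfl, hT⟩)
  set C₀ := D.κ + D.b * T * V with hC₀
  have hC₀' : 0 ≤ C₀ := by positivity
  refine ⟨2 * C₀ * Real.exp (K * T), by positivity, fun ε hε h hs t ht => ?_⟩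
  -- the residual of `h₀` in the equation with parameter `ε`
  have hres : ∀ t ∈ Icc 0 T,
      |D.truncOp ε m h₀ t - D.truncOp ε₀ m h₀ t| ≤ C₀ * |ε - ε₀| := by
    intro t ht
    rw [truncOp, truncOp, D.avg_sub (D.continuous_src ε cv) (D.continuous_src ε₀ cv)]
    refine D.abs_avg_le ht.1 fun s hs' => ?_
    have hsT : s ∈ Icc 0 T := ⟨hs'.1, hs'.2.trans ht.2⟩
    set p := height (D.vel fun s => max (h₀ s) m) s
    have e : D.src ε (D.vel fun s => max (h₀ s) m) s - D.src ε₀ (D.vel fun s => max (h₀ s) m) s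
        = (D.κ * clamp p - D.b * s * (D.vel (fun s => max (h₀ s) m) s)) * (ε - ε₀) := by
      simp only [src, react]; ring
    rw [e, abs_mul]
    have h1 := hV s hsT
    rw [Real.norm_eq_abs] at h1
    have h2 : |D.κ * clamp p| ≤ D.κ := by
      rw [abs_of_nonneg (mul_nonneg hκ.le (clamp_nonneg p))]
      exact mul_le_of_le_one_right hκ.le (clamp_le_one p)
    have h3 : |D.b * s * (D.vel (fun s => max (h₀ s) m) s)| ≤ D.b * T * V := by
      rw [abs_mul, abs_mul, abs_of_pos hb, abs_of_nonneg hsT.1]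
      have := hsT.1
      have := hsT.2
      gcongr
    have h4 := (abs_sub (D.κ * clamp p) (D.b * s * (D.vel (fun s => max (h₀ s) m) s))).trans
      (add_le_add h2 h3)
    gcongr
  -- the maximum `d` of the weighted difference satisfies `d ≤ d / 2 + C₀ |ε - ε₀|`
  have cw : Continuous fun s => Real.exp (-(K * s)) * |h s - h₀ s| := by
    have := hs.cont
    have := hs₀.cont
    fun_prop
  obtain ⟨t₁, ht₁, hmax⟩ := isCompact_Icc.exists_isMaxOn (nonempty_Icc.2 hT) cw.continuousOn
  set d := Real.exp (-(K * t₁)) * |h t₁ - h₀ t₁| with hd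
  have hd0 : 0 ≤ d := by positivity
  have hbound : ∀ s ∈ Icc 0 T, |h s - h₀ s| ≤ d * Real.exp (K * s) := fun s hs' => by
    have h1 : Real.exp (-(K * s)) * |h s - h₀ s| ≤ d := hmax hs'
    calc |h s - h₀ s| = (Real.exp (-(K * s)) * |h s - h₀ s|) * Real.exp (K * s) := by
          rw [mul_right_comm, ← Real.exp_add, neg_add_cancel, Real.exp_zero, one_mul]
      _ ≤ d * Real.exp (K * s) := by gcongr
  have hdle : d ≤ d / 2 + C₀ * |ε - ε₀| := by
    have h1 := hcontr ε hε h h₀ hs.cont hs₀.cont d hd0 t₁ ht₁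
      fun s hs' => hbound s ⟨hs'.1, hs'.2.trans ht₁.2⟩
    have h2 := hres t₁ ht₁
    have h3 : |h t₁ - h₀ t₁| ≤ d / 2 * Real.exp (K * t₁) + C₀ * |ε - ε₀| := by
      rw [hs.eq t₁ ht₁, hs₀.eq t₁ ht₁]
      exact (abs_sub_le _ _ _).trans (add_le_add h1 h2)
    have h4 : Real.exp (-(K * t₁)) ≤ 1 :=
      Real.exp_le_one_iff.2 (neg_nonpos.2 (mul_nonneg hK.le ht₁.1))
    calc d ≤ Real.exp (-(K * t₁)) * (d / 2 * Real.exp (K * t₁) + C₀ * |ε - ε₀|) := by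
          rw [hd]; gcongr
      _ = d / 2 * (Real.exp (-(K * t₁)) * Real.exp (K * t₁))
          + Real.exp (-(K * t₁)) * (C₀ * |ε - ε₀|) := by ring
      _ ≤ d / 2 + 1 * (C₀ * |ε - ε₀|) := by
          rw [← Real.exp_add, neg_add_cancel, Real.exp_zero, mul_one]
          gcongr
      _ = _ := by rw [one_mul]
  calc |h t - h₀ t| ≤ d * Real.exp (K * t) := hbound t ht
    _ ≤ (2 * C₀ * |ε - ε₀|) * Real.exp (K * T) := by
        have := exp_mul_mono hK ht.2
        gcongr
        linarith
    _ = _ := by ring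

lemma Trunc.unique {ε m T : ℝ} {h₁ h₂ : ℝ → ℝ} (hm : 0 < m) (hs₁ : D.Trunc ε m T h₁)
    (hs₂ : D.Trunc ε m T h₂) : EqOn h₁ h₂ (Icc 0 T) := fun t ht => by
  obtain ⟨C, -, hC⟩ := hs₂.stable hm |ε|
  have := hC ε le_rfl h₁ hs₁ t ht
  rw [sub_self, abs_zero, mul_zero] at this
  exact sub_eq_zero.1 (abs_nonpos_iff.1 this)

/-! ### Uniqueness, continuation and perturbation of positive solutions -/

lemma Sol.exists_lower {ε T : ℝ} {h : ℝ → ℝ} (hs : D.Sol ε T h) :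
    ∃ m, 0 < m ∧ ∀ t ∈ Icc 0 T, m < h t := by
  rcases lt_or_ge T 0 with hT | hT
  · exact ⟨1, one_pos, fun t ht => absurd (ht.1.trans ht.2) (not_le.2 hT)⟩
  obtain ⟨t₀, ht₀, hmin⟩ := isCompact_Icc.exists_isMinOn (nonempty_Icc.2 hT) hs.cont.continuousOn
  have := hs.pos t₀ ht₀
  exact ⟨h t₀ / 2, by positivity, fun t ht => by
    have : h t₀ ≤ h t := hmin ht
    linarith⟩

lemma Sol.unique {ε T : ℝ} {h₁ h₂ : ℝ → ℝ} (hs₁ : D.Sol ε T h₁) (hs₂ : D.Sol ε T h₂) :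
    EqOn h₁ h₂ (Icc 0 T) := by
  obtain ⟨m₁, p₁, l₁⟩ := hs₁.exists_lower
  obtain ⟨m₂, p₂, l₂⟩ := hs₂.exists_lower
  exact (hs₁.trunc fun t ht => (min_le_left m₁ m₂).trans (l₁ t ht).le).unique (lt_min p₁ p₂)
    (hs₂.trunc fun t ht => (min_le_right m₁ m₂).trans (l₂ t ht).le)

/-- A continuous function above `m` on `[0, T]` stays above `m` a little longer. -/
lemma exists_gt_forall_lt {h : ℝ → ℝ} (hh : Continuous h) {m T : ℝ} (hT : 0 ≤ T)
    (hm : ∀ t ∈ Icc 0 T, m < h t) : ∃ T' > T, ∀ t ∈ Icc 0 T', m < h t := by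
  have h1 : ∀ᶠ t in 𝓝 T, m < h t := continuous_const.continuousAt.eventually_lt hh.continuousAt
    (hm T ⟨hT, le_rfl⟩)
  obtain ⟨r, hr, hball⟩ := Metric.eventually_nhds_iff.1 h1
  refine ⟨T + r / 2, by linarith, fun t ht => ?_⟩
  rcases le_or_gt t T with h2 | h2
  · exact hm t ⟨ht.1, h2⟩
  · refine hball ?_
    rw [Real.dist_eq, abs_of_pos (by linarith)]
    linarith [ht.2]

lemma Sol.extend {ε T : ℝ} {h : ℝ → ℝ} (hT : 0 ≤ T) (hs : D.Sol ε T h) :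
    ∃ T' > T, ∃ h', D.Sol ε T' h' := by
  obtain ⟨m, hm, hlow⟩ := hs.exists_lower
  obtain ⟨u, hu⟩ := D.exists_trunc ε hm (by linarith : 0 ≤ T + 1)
  have e : EqOn u h (Icc 0 T) :=
    (hu.mono (by linarith)).unique hm (hs.trunc fun t ht => (hlow t ht).le)
  obtain ⟨T', hT', h2⟩ := exists_gt_forall_lt hu.cont hT (m := m) fun t ht => by
    rw [e ht]; exact hlow t ht
  refine ⟨min T' (T + 1), lt_min hT' (by linarith), u, (hu.mono (min_le_right _ _)).sol hm ?_⟩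
  exact fun t ht => (h2 t ⟨ht.1, ht.2.trans (min_le_left _ _)⟩).le

/-- Solutions on a compact interval persist, and their values at the right end vary continuously,
under changes of the parameter. -/
lemma Sol.perturb {ε₀ T η : ℝ} {h₀ : ℝ → ℝ} (hT : 0 ≤ T) (hs : D.Sol ε₀ T h₀) (hη : 0 < η) :
    ∀ᶠ ε in 𝓝 ε₀, ∃ h, D.Sol ε T h ∧ |h T - h₀ T| < η ∧
      |height (D.vel h) T - height (D.vel h₀) T| < η := by
  obtain ⟨m, hm, hlow⟩ := hs.exists_lower
  set m' := m / 2 with hm'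
  have hm'0 : 0 < m' := by positivity
  obtain ⟨C, hC, hst⟩ := (hs.trunc (m := m') fun t ht => by linarith [hlow t ht]).stable hm'0
    (|ε₀| + 1)
  set L := D.velLip m' T with hL
  have hL0 : 0 ≤ L := velLip_nonneg _ _
  have h1 : ∀ᶠ ε in 𝓝 ε₀, |ε| ≤ |ε₀| + 1 :=
    (continuous_abs.tendsto ε₀).eventually (eventually_le_nhds (by linarith))
  have hlim : ∀ c : ℝ, ∀ r > 0, ∀ᶠ ε in 𝓝 ε₀, c * |ε - ε₀| < r := fun c r hr => by
    have : Tendsto (fun ε => c * |ε - ε₀|) (𝓝 ε₀) (𝓝 (c * |ε₀ - ε₀|)) :=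
      (by fun_prop : Continuous fun ε => c * |ε - ε₀|).tendsto ε₀
    rw [sub_self, abs_zero, mul_zero] at this
    exact this.eventually (gt_mem_nhds hr)
  filter_upwards [h1, hlim C m' hm'0, hlim C η hη, hlim (L * C * T) η hη] with ε e1 e2 e3 e4
  obtain ⟨h, hh⟩ := D.exists_trunc ε hm'0 hT
  have hclose := hst ε e1 h hh
  have hge : ∀ t ∈ Icc 0 T, m' ≤ h t := fun t ht => by
    have := (abs_le.1 (hclose t ht)).1
    have := hlow t ht
    linarith
  refine ⟨h, hh.sol hm'0 hge, (hclose T ⟨hT, le_rfl⟩).trans_lt e3, ?_⟩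
  refine (abs_height_sub_le (D.continuous_vel hh.cont) (D.continuous_vel hs.cont) hT
    (C := L * (C * |ε - ε₀|)) fun s hs' => ?_).trans_lt (by linarith)
  have e1 : D.vel h s = D.vel (fun s => max (h s) m') s := by
    simp only [vel, max_eq_left (hge s hs')]
  have e2 : D.vel h₀ s = D.vel (fun s => max (h₀ s) m') s := by
    simp only [vel]
    rw [max_eq_left (by linarith [hlow s hs'])]
  rw [e1, e2]
  exact (abs_vel_sub_le hm'0 hs' h h₀).trans (mul_le_mul_of_nonneg_left (hclose s hs') hL0)

/-! ### Elementary properties of positive solutions -/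

lemma Sol.rpow_mul_eq {ε T t : ℝ} {h : ℝ → ℝ} (hs : D.Sol ε T h) (ht : t ∈ Icc 0 T) :
    t ^ (D.δ + 1) * h t = D.prim (D.src ε (D.vel h)) t := by
  rw [hs.eq t ht, D.rpow_mul_avg _ ht.1]

lemma rpow_δ_add_one {t : ℝ} (ht : 0 ≤ t) : t ^ (D.δ + 1) = t ^ D.δ * t := by
  have := D.δ_pos
  rw [Real.rpow_add_one' ht (by linarith)]

lemma hasDerivAt_rpow_δ_add_one (t : ℝ) :
    HasDerivAt (fun t : ℝ => t ^ (D.δ + 1)) ((D.δ + 1) * t ^ D.δ) t := by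
  have := D.δ_pos
  simpa using Real.hasDerivAt_rpow_const (x := t) (p := D.δ + 1) (Or.inr (by linarith))

lemma Sol.vel_pow {ε T t : ℝ} {h : ℝ → ℝ} (hs : D.Sol ε T h) (ht : t ∈ Icc 0 T) :
    D.vel h t ^ D.k = t * h t :=
  D.rt_pow (mul_nonneg ht.1 (hs.pos t ht).le)

lemma Sol.flux_eq {ε T t : ℝ} {h : ℝ → ℝ} (hs : D.Sol ε T h) (ht : t ∈ Icc 0 T) :
    t ^ D.δ * D.vel h t ^ D.k = D.prim (D.src ε (D.vel h)) t := by
  rw [← hs.rpow_mul_eq ht, hs.vel_pow ht, rpow_δ_add_one ht.1, mul_assoc]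

lemma Sol.vel_pos {ε T t : ℝ} {h : ℝ → ℝ} (hs : D.Sol ε T h) (ht : t ∈ Ioc 0 T) :
    0 < D.vel h t :=
  D.rt_pos (mul_pos ht.1 (hs.pos t ⟨ht.1.le, ht.2⟩))

lemma height_vel_antitone {h : ℝ → ℝ} (hh : Continuous h) : Antitone (height (D.vel h)) :=
  height_antitone (D.continuous_vel hh) fun t => D.vel_nonneg h t

lemma height_vel_le_one {h : ℝ → ℝ} (hh : Continuous h) {t : ℝ} (ht : 0 ≤ t) :
    height (D.vel h) t ≤ 1 := by
  simpa using height_vel_antitone hh ht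

lemma Sol.height_lt {ε T s t : ℝ} {h : ℝ → ℝ} (hsol : D.Sol ε T h) (hs : 0 ≤ s) (hst : s < t)
    (ht : t ≤ T) : height (D.vel h) t < height (D.vel h) s := by
  have cv := D.continuous_vel hsol.cont
  have h1 : 0 < ∫ τ in s..t, D.vel h τ :=
    intervalIntegral.intervalIntegral_pos_of_pos_on (cv.intervalIntegrable _ _)
      (fun τ hτ => hsol.vel_pos ⟨hs.trans_lt hτ.1, hτ.2.le.trans ht⟩) hst
  have h2 := intervalIntegral.integral_add_adjacent_intervals
    (cv.intervalIntegrable 0 s) (cv.intervalIntegrable (μ := MeasureTheory.volume) s t)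
  simp only [height]
  linarith

/-- Lower barrier: as long as the height is at least `η`, the unknown cannot drop to a level `m` at
which the production `react ε η` still beats the damping `ε b t v` and the dilution `(δ + 1) h`. -/
lemma Sol.barrier {ε T m η : ℝ} {h : ℝ → ℝ} (hε : 0 ≤ ε) (hs : D.Sol ε T h) (hm : 0 < m)
    (hη : η ≤ height (D.vel h) T)
    (hbar : ε * D.b * T * D.rt (T * m) + (D.δ + 1) * m < D.react ε η) :
    ∀ t ∈ Icc 0 T, m ≤ h t := by
  intro t ht
  have hT : 0 ≤ T := ht.1.trans ht.2
  have hδ := D.δ_pos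
  have hb := D.b_pos
  have hanti := height_vel_antitone (D := D) hs.cont
  have h0 : m < h 0 := by
    rw [hs.eq 0 ⟨le_rfl, hT⟩, D.avg_zero, lt_div_iff₀ (by linarith)]
    have h1 : D.react ε η ≤ D.react ε 1 := by
      refine D.react_mono hε (hη.trans (height_vel_le_one hs.cont hT))
    have h2 : 0 ≤ ε * D.b * T * D.rt (T * m) :=
      mul_nonneg (by positivity) (D.rt_nonneg _)
    simp only [src, height_zero]
    linarith
  rcases ht.1.eq_or_lt with rfl | ht0
  · exact h0.le
  obtain ⟨r, hr, hr'⟩ := exists_gt_forall_lt hs.cont le_rfl (m := m) (T := 0)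
    fun s hs' => by rwa [le_antisymm hs'.2 hs'.1]
  set s₀ := min r t with hs₀
  have hs₀0 : 0 < s₀ := lt_min hr ht0
  have hs₀t : s₀ ≤ t := min_le_right _ _
  have csrc := D.continuous_src ε (D.continuous_vel hs.cont)
  have hd : ∀ x, HasDerivAt (fun t => m * t ^ (D.δ + 1) - D.prim (D.src ε (D.vel h)) t)
      (m * ((D.δ + 1) * x ^ D.δ) - x ^ D.δ * D.src ε (D.vel h) x) x := fun x =>
    ((hasDerivAt_rpow_δ_add_one x).const_mul m).sub (D.hasDerivAt_prim csrc x)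
  have key := image_le_of_deriv_right_lt_deriv_boundary' (a := s₀) (b := T)
    (f := fun t => m * t ^ (D.δ + 1) - D.prim (D.src ε (D.vel h)) t)
    (fun x _ => (hd x).continuousAt.continuousWithinAt)
    (fun x _ => (hd x).hasDerivWithinAt) (B := fun _ => 0) (B' := fun _ => 0) ?_
    continuousOn_const (fun x _ => hasDerivWithinAt_const _ _ _) ?_ (x := t) ⟨hs₀t, ht.2⟩
  · simp only [← hs.rpow_mul_eq ht] at key
    have : 0 < t ^ (D.δ + 1) := Real.rpow_pos_of_pos ht0 _
    nlinarith
  · have hmem : s₀ ∈ Icc 0 T := ⟨hs₀0.le, hs₀t.trans ht.2⟩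
    simp only [← hs.rpow_mul_eq hmem]
    have h1 := (hr' s₀ ⟨hs₀0.le, min_le_left _ _⟩).le
    have h2 : 0 < s₀ ^ (D.δ + 1) := Real.rpow_pos_of_pos hs₀0 _
    nlinarith
  · intro x hx hx0
    have hmem : x ∈ Icc 0 T := ⟨hs₀0.le.trans hx.1, hx.2.le⟩
    have hx0' : 0 < x := hs₀0.trans_le hx.1
    have hp : 0 < x ^ (D.δ + 1) := Real.rpow_pos_of_pos hx0' _
    have hp' : 0 < x ^ D.δ := Real.rpow_pos_of_pos hx0' _
    simp only [← hs.rpow_mul_eq hmem] at hx0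
    have hxm : h x = m := by
      have : x ^ (D.δ + 1) * (m - h x) = 0 := by linarith
      have := (mul_eq_zero.1 this).resolve_left hp.ne'
      linarith
    have hv : D.vel h x ≤ D.rt (T * m) := by
      rw [vel, hxm]
      exact D.rt_mono (mul_le_mul_of_nonneg_right hmem.2 hm.le)
    have hv0 := D.vel_nonneg h x
    have h1 : ε * D.b * x * D.vel h x ≤ ε * D.b * T * D.rt (T * m) := by
      have := hmem.2
      gcongr
    have h2 : D.react ε η ≤ D.react ε (height (D.vel h) x) :=
      D.react_mono hε (hη.trans (hanti hmem.2))
    have h3 : (D.δ + 1) * m < D.src ε (D.vel h) x := by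
      rw [src]; linarith
    nlinarith

/-! ### The two competing open conditions on the parameter -/

variable (D) in
/-- The profile crosses zero. -/
def Crosses (ε : ℝ) : Prop :=
  ∃ T, 0 ≤ T ∧ ∃ h, D.Sol ε T h ∧ height (D.vel h) T < 0

variable (D) in
/-- The profile enters the region `v^k < ε b t φ`, `a φ^(q-1) < ε (b (δ + 1) - κ)`, which it can
never leave: there `t^δ (ε b t φ - v^k)` is increasing. In terms of `h` the first inequality
reads `h < ε b φ`. -/
def Trapped (ε : ℝ) : Prop :=
  ∃ T, 0 ≤ T ∧ ∃ h, D.Sol ε T h ∧ h T < ε * D.b * height (D.vel h) T ∧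
    D.a * height (D.vel h) T ^ (D.q - 1) < ε * (D.b * (D.δ + 1) - D.κ)

lemma isOpen_crosses : IsOpen {ε | D.Crosses ε} := by
  rw [isOpen_iff_mem_nhds]
  rintro ε ⟨T, hT, h, hs, hneg⟩
  filter_upwards [hs.perturb hT (neg_pos.2 hneg)] with ε' hε'
  obtain ⟨h', hs', -, hh⟩ := hε'
  refine ⟨T, hT, h', hs', ?_⟩
  have := (abs_lt.1 hh).2
  linarith

lemma isOpen_trapped : IsOpen {ε | D.Trapped ε} := by
  rw [isOpen_iff_mem_nhds]
  rintro ε ⟨T, hT, h, hs, h1, h2⟩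
  have hq := D.one_lt_q
  have hU : IsOpen {x : ℝ × ℝ × ℝ | x.2.1 < x.1 * D.b * x.2.2 ∧
      D.a * x.2.2 ^ (D.q - 1) < x.1 * (D.b * (D.δ + 1) - D.κ)} := by
    have c : Continuous fun x : ℝ × ℝ × ℝ => x.2.2 ^ (D.q - 1) :=
      (continuous_snd.snd).rpow_const fun _ => Or.inr (by linarith)
    have c1 : IsOpen {x : ℝ × ℝ × ℝ | x.2.1 < x.1 * D.b * x.2.2} :=
      isOpen_lt (by fun_prop) (by fun_prop)
    have c2 : IsOpen {x : ℝ × ℝ × ℝ |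
        D.a * x.2.2 ^ (D.q - 1) < x.1 * (D.b * (D.δ + 1) - D.κ)} :=
      isOpen_lt (by fun_prop) (by fun_prop)
    exact c1.inter c2
  obtain ⟨r, hr, hball⟩ := Metric.isOpen_iff.1 hU (ε, h T, height (D.vel h) T) ⟨h1, h2⟩
  filter_upwards [hs.perturb hT hr, Metric.ball_mem_nhds ε hr] with ε' hex hε'
  obtain ⟨h', hs', d1, d2⟩ := hex
  have hmem : (ε', h' T, height (D.vel h') T) ∈ Metric.ball (ε, h T, height (D.vel h) T) r := by
    rw [Metric.mem_ball, Prod.dist_eq, Prod.dist_eq, max_lt_iff, max_lt_iff]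
    exact ⟨hε', by rwa [Real.dist_eq], by rwa [Real.dist_eq]⟩
  have := hball hmem
  exact ⟨T, hT, h', hs', this.1, this.2⟩

lemma not_crosses_and_trapped {ε : ℝ} (hε : 0 ≤ ε) (hA : D.Crosses ε) (hB : D.Trapped ε) :
    False := by
  obtain ⟨T, hT, h, hs, hneg⟩ := hA
  obtain ⟨T', hT', h', hs', h1, h2⟩ := hB
  have hb := D.b_pos
  have hq := D.one_lt_q
  have hδ := D.δ_pos
  have ha := D.a_pos
  have hpos' : 0 < height (D.vel h') T' := by
    have := hs'.pos T' ⟨hT', le_rfl⟩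
    refine pos_of_mul_pos_right (a := ε * D.b) (this.trans h1) (by positivity)
  rcases le_or_gt T T' with hTT | hTT
  · have e : height (D.vel h) T = height (D.vel h') T :=
      height_congr hT (vel_congr (hs.unique (hs'.mono hTT)))
    have := height_vel_antitone (D := D) hs'.cont hTT
    linarith
  have e := (hs.mono hTT.le).unique hs'
  rw [← e ⟨hT', le_rfl⟩, ← height_congr hT' (vel_congr e)] at h1
  rw [← height_congr hT' (vel_congr e)] at h2 hpos'
  have cv := D.continuous_vel hs.cont
  have hanti := height_vel_antitone (D := D) hs.cont
  obtain ⟨t₁, ht₁, hz⟩ : (0 : ℝ) ∈ height (D.vel h) '' Icc T' T :=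
    intermediate_value_Icc' hTT.le (continuous_height cv).continuousOn ⟨hneg.le, hpos'.le⟩
  have csrc := D.continuous_src ε cv
  have hd : ∀ x, HasDerivAt (fun t => ε * D.b * (t ^ (D.δ + 1) * height (D.vel h) t)
      - D.prim (D.src ε (D.vel h)) t) (ε * D.b * ((D.δ + 1) * x ^ D.δ * height (D.vel h) x
        + x ^ (D.δ + 1) * -D.vel h x) - x ^ D.δ * D.src ε (D.vel h) x) x := fun x =>
    (((hasDerivAt_rpow_δ_add_one x).mul (hasDerivAt_height cv x)).const_mul _).sub
      (D.hasDerivAt_prim csrc x)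
  have hmono := monotoneOn_of_deriv_nonneg (convex_Icc T' t₁)
    (fun x _ => (hd x).continuousAt.continuousWithinAt)
    (fun x _ => (hd x).differentiableAt.differentiableWithinAt) ?_
    ⟨le_rfl, ht₁.1⟩ ⟨ht₁.1, le_rfl⟩ ht₁.1
  · simp only [← hs.rpow_mul_eq ⟨hT', hTT.le⟩, ← hs.rpow_mul_eq ⟨hT'.trans ht₁.1, ht₁.2⟩, hz]
      at hmono
    have hlt : T' < t₁ := by
      refine lt_of_le_of_ne ht₁.1 ?_
      rintro rfl
      linarith
    have h3 : 0 < t₁ ^ (D.δ + 1) * h t₁ :=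
      mul_pos (Real.rpow_pos_of_pos (hT'.trans_lt hlt) _) (hs.pos t₁ ⟨hT'.trans ht₁.1, ht₁.2⟩)
    have h4 : 0 ≤ T' ^ (D.δ + 1) := Real.rpow_nonneg hT' _
    nlinarith
  · intro x hx
    rw [interior_Icc] at hx
    rw [(hd x).deriv]
    have hx0 : 0 < x := hT'.trans_lt hx.1
    set p := height (D.vel h) x with hp
    have hp0 : 0 ≤ p := by rw [← hz]; exact hanti hx.2.le
    have hp1 : p ≤ 1 := height_vel_le_one hs.cont hx0.le
    have hpT : p ≤ height (D.vel h) T' := hanti hx.1.le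
    have h3 : D.a * p ^ (D.q - 1) ≤ ε * (D.b * (D.δ + 1) - D.κ) :=
      le_trans (by gcongr) h2.le
    have h5 : p ^ D.q = p ^ (D.q - 1) * p := by
      rw [← Real.rpow_add_one' hp0 (by linarith)]
      congr 1
      ring
    rw [src, D.react_of_mem hp0 hp1, rpow_δ_add_one hx0.le, h5]
    have h6 : 0 ≤ x ^ D.δ := Real.rpow_nonneg hx0.le _
    calc (0 : ℝ) ≤ x ^ D.δ * (p * (ε * (D.b * (D.δ + 1) - D.κ) - D.a * p ^ (D.q - 1))) :=
          mul_nonneg h6 (mul_nonneg hp0 (sub_nonneg.2 h3))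
      _ = _ := by ring

lemma sol_zero (ε : ℝ) (hε : 0 ≤ ε) : D.Sol ε 0 fun _ => (ε * D.κ + D.a) / (D.δ + 1) := by
  have hκ := D.κ_pos
  have ha := D.a_pos
  have hδ := D.δ_pos
  refine ⟨continuous_const, fun t _ => by positivity, fun t ht => ?_⟩
  obtain rfl : t = 0 := le_antisymm ht.2 ht.1
  rw [D.avg_zero, src, height_zero, D.react_of_mem zero_le_one le_rfl]
  simp

/-- For large `ε` the profile is trapped from the start. -/
lemma exists_trapped : ∃ ε, 0 ≤ ε ∧ D.Trapped ε := by
  have hκ := D.κ_pos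
  have ha := D.a_pos
  have hδ := D.δ_pos
  have hκb := D.κ_lt
  have hgap : 0 < D.b * (D.δ + 1) - D.κ := by linarith
  have key : D.a < (D.a / (D.b * (D.δ + 1) - D.κ) + 1) * (D.b * (D.δ + 1) - D.κ) := by
    rw [add_mul, div_mul_cancel₀ _ hgap.ne']
    linarith
  set ε := D.a / (D.b * (D.δ + 1) - D.κ) + 1 with hε
  have hε0 : 0 ≤ ε := by positivity
  refine ⟨ε, hε0, 0, le_rfl, _, sol_zero ε hε0, ?_, ?_⟩
  · rw [height_zero, div_lt_iff₀ (by linarith)]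
    linarith
  · rwa [height_zero, Real.one_rpow, mul_one]

/-! ### The maximal positive profile -/

variable (D) in
/-- The times up to which a positive solution exists. -/
def life (ε : ℝ) : Set ℝ := {T | 0 ≤ T ∧ ∃ h, D.Sol ε T h}

open Classical in
variable (D) in
/-- The maximal solution of the integral equation, set to zero outside its life time. -/
noncomputable def prof (ε t : ℝ) : ℝ := if H : t ∈ D.life ε then H.2.choose t else 0

variable (D) in
/-- The speed of the maximal solution. -/
noncomputable def speed (ε : ℝ) : ℝ → ℝ := D.vel (D.prof ε)

variable (D) in
/-- The height of the maximal solution. -/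
noncomputable def phi (ε : ℝ) : ℝ → ℝ := height (D.speed ε)

lemma mem_life_of_le {ε s t : ℝ} (ht : t ∈ D.life ε) (hs : 0 ≤ s) (hst : s ≤ t) :
    s ∈ D.life ε := ⟨hs, ht.2.imp fun _ h => h.mono hst⟩

lemma zero_mem_life {ε : ℝ} (hε : 0 ≤ ε) : (0 : ℝ) ∈ D.life ε := ⟨le_rfl, _, sol_zero ε hε⟩

lemma exists_gt_mem_life {ε t : ℝ} (ht : t ∈ D.life ε) : ∃ t' > t, t' ∈ D.life ε := by
  obtain ⟨h0, h, hs⟩ := ht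
  obtain ⟨t', h1, h2⟩ := hs.extend h0
  exact ⟨t', h1, h0.trans h1.le, h2⟩

lemma Sol.prof_eqOn {ε T : ℝ} {h : ℝ → ℝ} (hs : D.Sol ε T h) :
    EqOn (D.prof ε) h (Icc 0 T) := fun t ht => by
  have H : t ∈ D.life ε := ⟨ht.1, h, hs.mono ht.2⟩
  rw [prof, dif_pos H]
  exact H.2.choose_spec.unique (hs.mono ht.2) ⟨ht.1, le_rfl⟩

lemma Sol.speed_eqOn {ε T : ℝ} {h : ℝ → ℝ} (hs : D.Sol ε T h) :
    EqOn (D.speed ε) (D.vel h) (Icc 0 T) := vel_congr hs.prof_eqOn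

lemma Sol.phi_eqOn {ε T : ℝ} {h : ℝ → ℝ} (hs : D.Sol ε T h) :
    EqOn (D.phi ε) (height (D.vel h)) (Icc 0 T) := fun _ ht =>
  height_congr ht.1 (hs.speed_eqOn.mono (Icc_subset_Icc_right ht.2))

lemma prof_of_notMem {ε t : ℝ} (ht : t ∉ D.life ε) : D.prof ε t = 0 := dif_neg ht

lemma speed_of_notMem {ε t : ℝ} (ht : t ∉ D.life ε) : D.speed ε t = 0 := by
  rw [speed, vel, prof_of_notMem ht, mul_zero, D.rt_of_nonpos le_rfl]

lemma speed_nonneg (ε t : ℝ) : 0 ≤ D.speed ε t := D.vel_nonneg _ _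

lemma prof_pos {ε t : ℝ} (ht : t ∈ D.life ε) : 0 < D.prof ε t := by
  obtain ⟨h0, h, hs⟩ := ht
  rw [hs.prof_eqOn ⟨h0, le_rfl⟩]
  exact hs.pos t ⟨h0, le_rfl⟩

lemma speed_pos {ε t : ℝ} (ht : t ∈ D.life ε) (h0 : 0 < t) : 0 < D.speed ε t :=
  D.rt_pos (mul_pos h0 (prof_pos ht))

lemma speed_pow {ε t : ℝ} (ht : t ∈ D.life ε) : D.speed ε t ^ D.k = t * D.prof ε t :=
  D.rt_pow (mul_nonneg ht.1 (prof_pos ht).le)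

@[simp] lemma phi_zero (ε : ℝ) : D.phi ε 0 = 1 := height_zero _

lemma phi_lt {ε s t : ℝ} (ht : t ∈ D.life ε) (h0 : 0 ≤ s) (hst : s < t) :
    D.phi ε t < D.phi ε s := by
  obtain ⟨ht0, h, hs⟩ := ht
  rw [hs.phi_eqOn ⟨ht0, le_rfl⟩, hs.phi_eqOn ⟨h0, hst.le⟩]
  exact hs.height_lt h0 hst le_rfl

lemma phi_le {ε s t : ℝ} (ht : t ∈ D.life ε) (h0 : 0 ≤ s) (hst : s ≤ t) :
    D.phi ε t ≤ D.phi ε s := by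
  rcases hst.eq_or_lt with rfl | h
  · exact le_rfl
  · exact (phi_lt ht h0 h).le

lemma phi_le_one {ε t : ℝ} (ht : t ∈ D.life ε) : D.phi ε t ≤ 1 := by
  simpa using phi_le ht le_rfl ht.1

/-- Without crossing, the maximal profile is positive during its life time: it could only reach
zero with positive speed. -/
lemma phi_pos {ε t : ℝ} (hA : ¬D.Crosses ε) (ht : t ∈ D.life ε) : 0 < D.phi ε t := by
  obtain ⟨t', hlt, ht'⟩ := exists_gt_mem_life ht
  refine lt_of_le_of_lt ?_ (phi_lt ht' ht.1 hlt)
  by_contra! hneg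
  obtain ⟨h0, h, hs⟩ := ht'
  rw [hs.phi_eqOn ⟨h0, le_rfl⟩] at hneg
  exact hA ⟨t', h0, h, hs, hneg⟩

/-- Near a positive time of its life the maximal profile agrees with a globally continuous one. -/
lemma exists_sol_nhds {ε t : ℝ} (ht : t ∈ D.life ε) (h0 : 0 < t) :
    ∃ T h, D.Sol ε T h ∧ t < T ∧ D.prof ε =ᶠ[𝓝 t] h ∧ D.speed ε =ᶠ[𝓝 t] D.vel h ∧
      D.phi ε =ᶠ[𝓝 t] height (D.vel h) := by
  obtain ⟨T, hT, -, h, hs⟩ := exists_gt_mem_life ht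
  have hn : Icc 0 T ∈ 𝓝 t := Icc_mem_nhds h0 hT
  exact ⟨T, h, hs, hT, hs.prof_eqOn.eventuallyEq_of_mem hn, hs.speed_eqOn.eventuallyEq_of_mem hn,
    hs.phi_eqOn.eventuallyEq_of_mem hn⟩

lemma hasDerivAt_phi {ε t : ℝ} (ht : t ∈ D.life ε) (h0 : 0 < t) :
    HasDerivAt (D.phi ε) (-D.speed ε t) t := by
  obtain ⟨T, h, hs, -, -, e2, e3⟩ := exists_sol_nhds ht h0
  rw [e2.eq_of_nhds]
  exact (hasDerivAt_height (D.continuous_vel hs.cont) t).congr_of_eventuallyEq e3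

lemma continuousAt_speed {ε t : ℝ} (ht : t ∈ D.life ε) (h0 : 0 < t) :
    ContinuousAt (D.speed ε) t := by
  obtain ⟨T, h, hs, -, -, e2, -⟩ := exists_sol_nhds ht h0
  exact (D.continuous_vel hs.cont).continuousAt.congr e2.symm

lemma hasDerivAt_flux {ε t : ℝ} (ht : t ∈ D.life ε) (h0 : 0 < t) :
    HasDerivAt (fun t => t ^ D.δ * D.speed ε t ^ D.k) (t ^ D.δ * D.src ε (D.speed ε) t) t := by
  obtain ⟨T, h, hs, hT, -, e2, e3⟩ := exists_sol_nhds ht h0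
  have e : D.src ε (D.speed ε) t = D.src ε (D.vel h) t := by
    rw [src, src, e2.eq_of_nhds]
    exact congrArg (fun x => D.react ε x - _) e3.eq_of_nhds
  rw [e]
  refine (D.hasDerivAt_prim (D.continuous_src ε (D.continuous_vel hs.cont)) t
    ).congr_of_eventuallyEq ?_
  filter_upwards [Icc_mem_nhds h0 hT, e2] with s hs' hs2
  rw [hs2, hs.flux_eq hs']

lemma continuousOn_phi {ε T : ℝ} (hT : T ∈ D.life ε) : ContinuousOn (D.phi ε) (Icc 0 T) := by
  obtain ⟨-, h, hs⟩ := hT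
  exact (continuous_height (D.continuous_vel hs.cont)).continuousOn.congr hs.phi_eqOn

lemma continuousOn_speed {ε T : ℝ} (hT : T ∈ D.life ε) : ContinuousOn (D.speed ε) (Icc 0 T) := by
  obtain ⟨-, h, hs⟩ := hT
  exact (D.continuous_vel hs.cont).continuousOn.congr hs.speed_eqOn

lemma exists_lower_prof {ε T : ℝ} (hT : T ∈ D.life ε) :
    ∃ m, 0 < m ∧ ∀ t ∈ Icc 0 T, m < D.prof ε t := by
  obtain ⟨-, h, hs⟩ := hT
  obtain ⟨m, hm, hl⟩ := hs.exists_lower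
  exact ⟨m, hm, fun t ht => by rw [hs.prof_eqOn ht]; exact hl t ht⟩

lemma flux_eq_prim {ε t : ℝ} (ht : t ∈ D.life ε) :
    t ^ D.δ * D.speed ε t ^ D.k = D.prim (D.src ε (D.speed ε)) t := by
  obtain ⟨h0, h, hs⟩ := ht
  rw [hs.speed_eqOn ⟨h0, le_rfl⟩, hs.flux_eq ⟨h0, le_rfl⟩, prim, prim]
  refine intervalIntegral.integral_congr fun s hs' => ?_
  rw [uIcc_of_le h0] at hs'
  simp only [D.src_congr ε hs.speed_eqOn hs']

lemma prof_barrier {ε T m η : ℝ} (hε : 0 ≤ ε) (hT : T ∈ D.life ε) (hm : 0 < m)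
    (hη : η ≤ D.phi ε T)
    (hbar : ε * D.b * T * D.rt (T * m) + (D.δ + 1) * m < D.react ε η) :
    ∀ t ∈ Icc 0 T, m ≤ D.prof ε t := by
  obtain ⟨h0, h, hs⟩ := hT
  intro t ht
  rw [hs.prof_eqOn ht]
  rw [hs.phi_eqOn ⟨h0, le_rfl⟩] at hη
  exact hs.barrier hε hm hη hbar t ht

/-- A life time that ends at a finite `S` ends by degeneration: the unknown is not bounded away
from zero. -/
lemma not_bounded_below {ε S m : ℝ} (hS : 0 < S) (hl : D.life ε = Ico 0 S) (hm : 0 < m) :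
    ∃ t ∈ D.life ε, D.prof ε t < m := by
  by_contra! hge
  obtain ⟨u, hu⟩ := D.exists_trunc ε hm hS.le
  have e : EqOn u (D.prof ε) (Ico 0 S) := fun t ht => by
    have ht' : t ∈ D.life ε := hl ▸ ht
    obtain ⟨h0, h, hs⟩ := ht'
    have h1 : ∀ s ∈ Icc 0 t, m ≤ h s := fun s hs' => by
      rw [← hs.prof_eqOn hs']
      exact hge s (hl ▸ ⟨hs'.1, hs'.2.trans_lt ht.2⟩)
    rw [hs.prof_eqOn ⟨h0, le_rfl⟩]
    exact (hu.mono ht.2.le).unique hm (hs.trunc h1) ⟨h0, le_rfl⟩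
  have h2 : ∀ t ∈ Ico 0 S, m ≤ u t := fun t ht => by
    rw [e ht]
    exact hge t (hl ▸ ht)
  have h3 : ∀ t ∈ Icc 0 S, m ≤ u t := by
    rw [← closure_Ico hS.ne]
    exact fun t ht => le_on_closure h2 continuousOn_const hu.cont.continuousOn ht
  have : S ∈ D.life ε := ⟨hS.le, u, hu.sol hm h3⟩
  rw [hl] at this
  exact lt_irrefl _ this.2

/-- The life time is either the whole half line or a half open interval. -/
lemma life_eq {ε : ℝ} (hε : 0 ≤ ε) : D.life ε = Ici 0 ∨ ∃ S, 0 < S ∧ D.life ε = Ico 0 S := by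
  by_cases hbdd : BddAbove (D.life ε)
  · right
    obtain ⟨t', h1, h2⟩ := exists_gt_mem_life (zero_mem_life (D := D) hε)
    refine ⟨sSup (D.life ε), h1.trans_le (le_csSup hbdd h2), ?_⟩
    ext t
    constructor
    · intro ht
      obtain ⟨t', h1, h2⟩ := exists_gt_mem_life ht
      exact ⟨ht.1, h1.trans_le (le_csSup hbdd h2)⟩
    · intro ht
      obtain ⟨s, hs, hlt⟩ := exists_lt_of_lt_csSup ⟨0, zero_mem_life hε⟩ ht.2
      exact mem_life_of_le hs ht.1 hlt.le
  · left
    ext t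
    refine ⟨fun ht => ht.1, fun ht => ?_⟩
    obtain ⟨s, hs, hlt⟩ := not_bddAbove_iff.1 hbdd t
    exact mem_life_of_le hs ht hlt.le

end Params
end KHessianProfile

namespace KHessianProfile

/-- If `u^k` is differentiable and `k` is odd, then so is `u^(k+1)`, also where `u` vanishes. -/
lemma hasDerivAt_pow_succ_of_odd {k : ℕ} (hk : Odd k) {u : ℝ → ℝ} {U' t : ℝ}
    (hu : HasDerivAt (fun s => u s ^ k) U' t) :
    HasDerivAt (fun s => u s ^ (k + 1)) (((k : ℝ) + 1) / k * u t * U') t := by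
  have hk0 : k ≠ 0 := by rintro rfl; simp at hk
  have hkpos : (0 : ℝ) < k := by exact_mod_cast Nat.pos_of_ne_zero hk0
  have hp : 1 < ((k : ℝ) + 1) / k := by rw [lt_div_iff₀ hkpos]; linarith
  have e1 : (fun s => u s ^ (k + 1)) = fun s => |u s ^ k| ^ (((k : ℝ) + 1) / k) := by
    funext s
    rw [abs_pow, ← Real.rpow_natCast_mul (abs_nonneg _), mul_div_cancel₀ _ hkpos.ne',
      ← hk.add_one.pow_abs]
    exact_mod_cast (Real.rpow_natCast (|u s|) (k + 1)).symm
  rw [e1]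
  refine ((hasDerivAt_abs_rpow (u t ^ k) hp).comp t hu).congr_deriv ?_
  rcases eq_or_ne (u t) 0 with h0 | h0
  · simp [h0, hk0]
  have h1 : |u t ^ k| ^ (((k : ℝ) + 1) / k - 2) * u t ^ k = u t := by
    have e2 : |u t ^ k| ^ (((k : ℝ) + 1) / k - 2) = (|u t| ^ (k - 1))⁻¹ := by
      rw [abs_pow, ← Real.rpow_natCast_mul (abs_nonneg _), ← Real.rpow_natCast,
        ← Real.rpow_neg (abs_nonneg _), Nat.cast_sub (Nat.one_le_iff_ne_zero.2 hk0)]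
      congr 1
      field_simp
      push_cast
      ring
    have e3 : u t ^ k = |u t| ^ (k - 1) * u t := by
      rw [(Nat.Odd.sub_odd hk odd_one).pow_abs, ← pow_succ, Nat.sub_add_cancel
        (Nat.one_le_iff_ne_zero.2 hk0)]
    rw [e2, e3, inv_mul_cancel_left₀ (by positivity)]
  rw [mul_assoc (((k : ℝ) + 1) / k), h1]

namespace Params
variable {D : Params}

/-! ### Crossing for the limit equation `ε = 0` -/

lemma le_avg {f : ℝ → ℝ} (hf : Continuous f) {t C : ℝ} (ht : 0 ≤ t)
    (h : ∀ s ∈ Icc 0 t, C ≤ f s) : C / (D.δ + 1) ≤ D.avg f t := by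
  have h1 := D.integral_rpow_δ 1
  rw [Real.one_rpow] at h1
  have h2 : C / (D.δ + 1) = ∫ σ in (0 : ℝ)..1, σ ^ D.δ * C := by
    rw [intervalIntegral.integral_mul_const, h1]; ring
  rw [h2, avg]
  refine intervalIntegral.integral_mono_on zero_le_one
    ((D.continuous_rpow_δ.mul continuous_const).intervalIntegrable _ _)
    ((D.continuous_rpow_δ.mul (hf.comp (continuous_id.mul continuous_const))
      ).intervalIntegrable _ _) fun σ hσ => ?_
  exact mul_le_mul_of_nonneg_left (h _ (mul_mem_Icc hσ ht)) (Real.rpow_nonneg hσ.1 _)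

lemma react_zero_le_prof {t : ℝ} (ht : t ∈ D.life 0) :
    D.react 0 (D.phi 0 t) / (D.δ + 1) ≤ D.prof 0 t := by
  obtain ⟨h0, h, hs⟩ := ht
  rw [hs.prof_eqOn ⟨h0, le_rfl⟩, hs.phi_eqOn ⟨h0, le_rfl⟩, hs.eq t ⟨h0, le_rfl⟩]
  refine le_avg (D.continuous_src 0 (D.continuous_vel hs.cont)) h0 fun s hs' => ?_
  rw [src, zero_mul, zero_mul, zero_mul, sub_zero]
  exact D.react_mono le_rfl (height_vel_antitone hs.cont hs'.2)

lemma src_zero (v : ℝ → ℝ) (t : ℝ) : D.src 0 v t = D.react 0 (height v t) := by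
  rw [src, zero_mul, zero_mul, zero_mul, sub_zero]

lemma flux_mono_zero {s t : ℝ} (ht : t ∈ D.life 0) (h0 : 0 < s) (hst : s ≤ t) :
    s ^ D.δ * D.speed 0 s ^ D.k ≤ t ^ D.δ * D.speed 0 t ^ D.k := by
  have hd : ∀ x ∈ Icc s t, HasDerivAt (fun t => t ^ D.δ * D.speed 0 t ^ D.k)
      (x ^ D.δ * D.src 0 (D.speed 0) x) x := fun x hx =>
    hasDerivAt_flux (mem_life_of_le ht (h0.le.trans hx.1) hx.2) (h0.trans_le hx.1)
  refine monotoneOn_of_deriv_nonneg (convex_Icc s t)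
    (fun x hx => (hd x hx).continuousAt.continuousWithinAt)
    (fun x hx => (hd x (interior_subset hx)).differentiableAt.differentiableWithinAt)
    (fun x hx => ?_) ⟨le_rfl, hst⟩ ⟨hst, le_rfl⟩ hst
  have hx := interior_subset hx
  rw [(hd x hx).deriv, src_zero]
  exact mul_nonneg (Real.rpow_nonneg (h0.le.trans hx.1) _) (D.react_nonneg le_rfl _)

/-- For `ε = 0` the flux `t^δ v^k` increases, so the profile cannot degenerate. -/
lemma life_zero : D.life 0 = Ici 0 := by
  rcases life_eq (D := D) le_rfl with h | ⟨S, hS, hl⟩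
  · exact h
  exfalso
  have hmid : S / 2 ∈ D.life 0 := by rw [hl]; constructor <;> linarith
  obtain ⟨m, hm, hlow⟩ := exists_lower_prof hmid
  set F := (S / 2) ^ D.δ * D.speed 0 (S / 2) ^ D.k with hF
  have hF0 : 0 < F := mul_pos (Real.rpow_pos_of_pos (by linarith) _)
    (pow_pos (speed_pos hmid (by linarith)) _)
  have hSN : 0 < S ^ D.δ * S := mul_pos (Real.rpow_pos_of_pos hS _) hS
  obtain ⟨t, ht, hlt⟩ := not_bounded_below hS hl (lt_min hm (div_pos hF0 hSN))
  rcases le_total t (S / 2) with h | h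
  · exact absurd (hlt.trans_le (min_le_left _ _)) (not_lt.2 (hlow t ⟨ht.1, h⟩).le)
  · have h1 := flux_mono_zero ht (by linarith) h
    rw [← hF, speed_pow ht] at h1
    have htS : t < S := by rw [hl] at ht; exact ht.2
    have h2 := hlt.trans_le (min_le_right _ _)
    have h3 := prof_pos ht
    rw [lt_div_iff₀ hSN] at h2
    have h4 : t ^ D.δ * (t * D.prof 0 t) ≤ S ^ D.δ * (S * D.prof 0 t) := by
      have := ht.1
      have := D.δ_pos
      gcongr
    nlinarith

/-- Doubling estimate: since the flux increases, the speed cannot fall by more than the factor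
`2^δ` on `[t, 2 t]`, whence `t v ≤ 2^δ φ`. -/
lemma mul_speed_le {t : ℝ} (hA : ¬D.Crosses 0) (ht : 0 < t) :
    t * D.speed 0 t ≤ (2 : ℝ) ^ D.δ * D.phi 0 t := by
  have hδ := D.δ_pos
  have hmem : ∀ s : ℝ, 0 ≤ s → s ∈ D.life 0 := fun s hs => by rw [life_zero]; exact hs
  obtain ⟨ξ, hξ, hslope⟩ := exists_hasDerivAt_eq_slope (D.phi 0) (fun s => -D.speed 0 s)
    (by linarith : t < 2 * t)
    ((continuousOn_phi (hmem (2 * t) (by linarith))).mono (Icc_subset_Icc_left ht.le))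
    fun x hx => hasDerivAt_phi (hmem x (ht.le.trans hx.1.le)) (ht.trans hx.1)
  have h2t := phi_pos hA (hmem (2 * t) (by linarith))
  have h1 : t * D.speed 0 ξ ≤ D.phi 0 t := by
    rw [eq_div_iff (by linarith)] at hslope
    linarith
  set c : ℝ := (2 : ℝ) ^ D.δ with hc
  have hc1 : 1 ≤ c := Real.one_le_rpow (by norm_num) hδ.le
  have h3 : D.speed 0 t ≤ c * D.speed 0 ξ := by
    refine le_of_pow_le_pow_left₀ D.k_ne_zero (mul_nonneg (by linarith) (speed_nonneg _ _)) ?_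
    have h4 := flux_mono_zero (hmem ξ (ht.le.trans hξ.1.le)) ht hξ.1.le
    have h5 : ξ ^ D.δ ≤ c * t ^ D.δ := by
      rw [hc, ← Real.mul_rpow two_pos.le ht.le]
      exact Real.rpow_le_rpow (ht.le.trans hξ.1.le) hξ.2.le hδ.le
    have h6 : 0 < t ^ D.δ := Real.rpow_pos_of_pos ht _
    have h7 : 0 ≤ D.speed 0 ξ ^ D.k := pow_nonneg (speed_nonneg _ _) _
    have h8 : D.speed 0 t ^ D.k ≤ c * D.speed 0 ξ ^ D.k := by
      refine le_of_mul_le_mul_left ?_ h6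
      nlinarith
    calc D.speed 0 t ^ D.k ≤ c * D.speed 0 ξ ^ D.k := h8
      _ ≤ c ^ D.k * D.speed 0 ξ ^ D.k := by
          gcongr
          exact le_self_pow₀ hc1 D.k_ne_zero
      _ = _ := (mul_pow _ _ _).symm
  nlinarith

variable (D) in
/-- The Pohozaev function `t^(δ+1) E + λ t^δ v^k φ` of the limit equation, where `E` is the energy
and `λ = 1 - (δ + 1)/(k + 1)` is chosen to remove `v^(k+1)` from the derivative. -/
noncomputable def pohozaev (t : ℝ) : ℝ :=
  t ^ (D.δ + 1) * (D.k / (D.k + 1) * D.speed 0 t ^ (D.k + 1)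
    + D.a / (D.q + 1) * D.phi 0 t ^ (D.q + 1))
    + (1 - (D.δ + 1) / (D.k + 1)) * (t ^ D.δ * D.speed 0 t ^ D.k * D.phi 0 t)

lemma hasDerivAt_pohozaev (hA : ¬D.Crosses 0) {t : ℝ} (ht : 0 < t) :
    HasDerivAt D.pohozaev (t ^ D.δ * (D.a * D.phi 0 t ^ (D.q + 1)) *
      ((D.δ + 1) / (D.q + 1) + 1 - (D.δ + 1) / (D.k + 1))) t := by
  have hmem : t ∈ D.life 0 := by rw [life_zero]; exact ht.le
  have hq := D.one_lt_q
  have hk := D.k_pos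
  have hφ := phi_pos hA hmem
  have hφ1 := phi_le_one hmem
  have hφ' := hasDerivAt_phi hmem ht
  have hflux := hasDerivAt_flux hmem ht
  have e0 : D.src 0 (D.speed 0) t = D.a * D.phi 0 t ^ D.q := by
    rw [src_zero]
    change D.react 0 (D.phi 0 t) = _
    rw [D.react_of_mem hφ.le hφ1]; ring
  rw [e0] at hflux
  have hpt : t ^ D.δ ≠ 0 := (Real.rpow_pos_of_pos ht _).ne'
  have hv : HasDerivAt (fun s => D.speed 0 s ^ D.k)
      (D.a * D.phi 0 t ^ D.q - D.δ / t * D.speed 0 t ^ D.k) t := by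
    have h1 := hflux.div (Real.hasDerivAt_rpow_const (p := D.δ) (Or.inl ht.ne')) hpt
    refine (h1.congr_deriv ?_).congr_of_eventuallyEq ?_
    · rw [Real.rpow_sub_one ht.ne']
      field_simp
    · filter_upwards [lt_mem_nhds ht] with s hs
      have : s ^ D.δ ≠ 0 := (Real.rpow_pos_of_pos hs _).ne'
      simp only [Pi.div_apply]
      rw [mul_div_cancel_left₀ _ this]
  have hv1 := hasDerivAt_pow_succ_of_odd D.k_odd hv
  have hφq := hφ'.rpow_const (p := D.q + 1) (Or.inl hφ.ne')
  have := ((hasDerivAt_rpow_δ_add_one (D := D) t).mul ((hv1.const_mul (D.k / (D.k + 1) : ℝ)).add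
    (hφq.const_mul (D.a / (D.q + 1))))).add
    ((hflux.mul hφ').const_mul (1 - (D.δ + 1) / (D.k + 1)))
  refine this.congr_deriv ?_
  have e1 : D.phi 0 t ^ (D.q + 1) = D.phi 0 t ^ D.q * D.phi 0 t := Real.rpow_add_one hφ.ne' _
  simp only [Pi.add_apply, rpow_δ_add_one ht.le, e1, add_sub_cancel_right, pow_succ]
  field_simp
  ring

lemma pohozaev_coeff_pos : 0 < (D.δ + 1) / (D.q + 1) + 1 - (D.δ + 1) / (D.k + 1) := by
  have hq := D.one_lt_q
  have hk := D.k_pos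
  have hs := D.subcritical
  have e : (D.δ + 1) / (D.q + 1) + 1 - (D.δ + 1) / (D.k + 1)
      = ((D.k + 1) * (D.q + 1) - (D.δ + 1) * (D.q - D.k)) / ((D.q + 1) * (D.k + 1)) := by
    field_simp
    ring
  rw [e]
  exact div_pos (by linarith) (by positivity)

lemma pohozaev_lower (hA : ¬D.Crosses 0) : ∃ c, 0 < c ∧ ∀ t, 1 ≤ t → c ≤ D.pohozaev t := by
  have hδ := D.δ_pos
  have hq := D.one_lt_q
  have hmem : ∀ s : ℝ, 0 ≤ s → s ∈ D.life 0 := fun s hs => by rw [life_zero]; exact hs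
  have hcont : ∀ T : ℝ, 0 ≤ T → ContinuousOn D.pohozaev (Icc 0 T) := fun T hT => by
    have h1 := continuousOn_speed (hmem T hT)
    have h2 := continuousOn_phi (hmem T hT)
    have h3 : ContinuousOn (fun t : ℝ => t ^ D.δ) (Icc 0 T) := D.continuous_rpow_δ.continuousOn
    have h4 : ContinuousOn (fun t : ℝ => t ^ (D.δ + 1)) (Icc 0 T) :=
      (continuous_id.rpow_const fun _ => Or.inr (by linarith)).continuousOn
    have h5 : ContinuousOn (fun t : ℝ => D.phi 0 t ^ (D.q + 1)) (Icc 0 T) :=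
      h2.rpow_const fun _ _ => Or.inr (by linarith)
    unfold pohozaev
    fun_prop
  have hderiv : ∀ t, 0 < t → 0 < deriv D.pohozaev t := fun t ht => by
    rw [(hasDerivAt_pohozaev hA ht).deriv]
    have := phi_pos hA (hmem t ht.le)
    have := D.a_pos
    have := Real.rpow_pos_of_pos ht D.δ
    exact mul_pos (by positivity) pohozaev_coeff_pos
  have hmono : ∀ T : ℝ, 0 ≤ T → StrictMonoOn D.pohozaev (Icc 0 T) := fun T hT =>
    strictMonoOn_of_deriv_pos (convex_Icc 0 T) (hcont T hT) fun t ht => by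
      rw [interior_Icc] at ht
      exact hderiv t ht.1
  have h0 : D.pohozaev 0 = 0 := by
    rw [pohozaev, Real.zero_rpow (by linarith), Real.zero_rpow (by linarith)]
    ring
  refine ⟨D.pohozaev 1, ?_, fun t ht => ?_⟩
  · rw [← h0]
    exact hmono 1 zero_le_one ⟨le_rfl, zero_le_one⟩ ⟨zero_le_one, le_rfl⟩ one_pos
  · exact (hmono t (by linarith)).monotoneOn ⟨zero_le_one, ht⟩ ⟨by linarith, le_rfl⟩ ht

/-- The decay `φ^(q-k) ≤ C t^(-k-1)`, from `t v ≤ 2^δ φ` and `v^k ≥ a t φ^q / (δ + 1)`. -/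
lemma phi_decay (hA : ¬D.Crosses 0) {t : ℝ} (ht : 0 < t) :
    D.a / (D.δ + 1) * (t ^ (D.k + 1) * D.phi 0 t ^ (D.q - D.k)) ≤ ((2 : ℝ) ^ D.δ) ^ D.k := by
  have hmem : t ∈ D.life 0 := by rw [life_zero]; exact ht.le
  have hφ := phi_pos hA hmem
  have h1 := mul_speed_le hA ht
  have h2 := react_zero_le_prof hmem
  rw [D.react_of_mem hφ.le (phi_le_one hmem)] at h2
  have h3 := pow_le_pow_left₀ (mul_nonneg ht.le (speed_nonneg 0 t)) h1 D.k
  rw [mul_pow, mul_pow, speed_pow hmem] at h3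
  have e : D.phi 0 t ^ D.q = D.phi 0 t ^ (D.q - D.k) * D.phi 0 t ^ D.k := by
    rw [← Real.rpow_add_natCast hφ.ne', sub_add_cancel]
  rw [e] at h2
  refine le_of_mul_le_mul_right ?_ (pow_pos hφ D.k)
  refine le_trans ?_ h3
  calc _ = t ^ D.k * (t * ((0 * D.κ * D.phi 0 t
        + D.a * (D.phi 0 t ^ (D.q - D.k) * D.phi 0 t ^ D.k)) / (D.δ + 1))) := by ring
    _ ≤ _ := by gcongr

lemma pohozaev_upper (hA : ¬D.Crosses 0) : ∃ M, 0 < M ∧ ∀ t, 0 < t →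
    D.pohozaev t ≤ M * (t ^ (D.δ + 1) * D.phi 0 t ^ (D.k + 1) / t ^ (D.k + 1)) := by
  have hδ := D.δ_pos
  have hq := D.one_lt_q
  have hk := D.k_pos
  have ha := D.a_pos
  set c : ℝ := (2 : ℝ) ^ D.δ with hc
  have hc0 : 0 < c := Real.rpow_pos_of_pos two_pos _
  set l := 1 - (D.δ + 1) / (D.k + 1) with hl
  refine ⟨D.k / (D.k + 1) * c ^ (D.k + 1) + (D.δ + 1) / (D.q + 1) * c ^ D.k + |l| * c ^ D.k,
    by positivity, fun t ht => ?_⟩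
  have hmem : t ∈ D.life 0 := by rw [life_zero]; exact ht.le
  have hφ := phi_pos hA hmem
  have hv := speed_nonneg (D := D) 0 t
  have hδt : 0 < t ^ D.δ := Real.rpow_pos_of_pos ht _
  have h1 := mul_speed_le hA ht
  rw [← hc] at h1
  have p1 := pow_le_pow_left₀ (mul_nonneg ht.le hv) h1 (D.k + 1)
  have p2 := pow_le_pow_left₀ (mul_nonneg ht.le hv) h1 D.k
  have p3 := phi_decay hA ht
  rw [← hc] at p3
  have e : D.phi 0 t ^ (D.q + 1) = D.phi 0 t ^ (D.q - D.k) * D.phi 0 t ^ (D.k + 1) := by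
    rw [← Real.rpow_add_natCast hφ.ne']
    push_cast
    congr 1
    ring
  set v := D.speed 0 t
  set p := D.phi 0 t with hp
  set X := t ^ (D.δ + 1) * p ^ (D.k + 1) / t ^ (D.k + 1) with hX
  have hN : t ^ (D.δ + 1) = t ^ D.δ * t := rpow_δ_add_one ht.le
  have hX0 : 0 ≤ X := by positivity
  have b1 : t ^ (D.δ + 1) * v ^ (D.k + 1) ≤ c ^ (D.k + 1) * X := by
    rw [hX, ← mul_div_assoc, le_div_iff₀ (by positivity), hN]
    calc _ = t ^ D.δ * t * (t * v) ^ (D.k + 1) := by ring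
      _ ≤ t ^ D.δ * t * (c * p) ^ (D.k + 1) := by gcongr
      _ = _ := by ring
  have b2 : t ^ (D.δ + 1) * p ^ (D.q + 1) ≤ (D.δ + 1) / D.a * c ^ D.k * X := by
    rw [hX, ← mul_div_assoc, le_div_iff₀ (by positivity), e, hN]
    have p4 : t ^ (D.k + 1) * p ^ (D.q - D.k) ≤ (D.δ + 1) / D.a * c ^ D.k := by
      rw [div_mul_eq_mul_div, le_div_iff₀ ha]
      rw [div_mul_eq_mul_div, div_le_iff₀ (by linarith)] at p3
      linarith
    calc _ = t ^ D.δ * t * p ^ (D.k + 1) * (t ^ (D.k + 1) * p ^ (D.q - D.k)) := by ring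
      _ ≤ t ^ D.δ * t * p ^ (D.k + 1) * ((D.δ + 1) / D.a * c ^ D.k) := by gcongr
      _ = _ := by ring
  have b3 : t ^ D.δ * v ^ D.k * p ≤ c ^ D.k * X := by
    rw [hX, ← mul_div_assoc, le_div_iff₀ (by positivity), hN]
    calc _ = t ^ D.δ * t * p * (t * v) ^ D.k := by ring
      _ ≤ t ^ D.δ * t * p * (c * p) ^ D.k := by gcongr
      _ = _ := by ring
  have b3' : l * (t ^ D.δ * v ^ D.k * p) ≤ |l| * (c ^ D.k * X) := by
    have : 0 ≤ t ^ D.δ * v ^ D.k * p := by positivity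
    calc _ ≤ |l| * (t ^ D.δ * v ^ D.k * p) := by gcongr; exact le_abs_self l
      _ ≤ _ := by gcongr
  calc D.pohozaev t = D.k / (D.k + 1) * (t ^ (D.δ + 1) * v ^ (D.k + 1))
        + D.a / (D.q + 1) * (t ^ (D.δ + 1) * p ^ (D.q + 1))
        + l * (t ^ D.δ * v ^ D.k * p) := by rw [pohozaev]; ring
    _ ≤ D.k / (D.k + 1) * (c ^ (D.k + 1) * X)
        + D.a / (D.q + 1) * ((D.δ + 1) / D.a * c ^ D.k * X) + |l| * (c ^ D.k * X) := by
        gcongr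
    _ = _ := by field_simp

/-- In the subcritical range the solution of the limit equation crosses zero: otherwise the
Pohozaev function would stay above a positive constant while decaying to zero. -/
lemma crosses_zero : D.Crosses 0 := by
  by_contra hA
  have hδ := D.δ_pos
  have hq := D.one_lt_q
  have hk := D.k_pos
  have ha := D.a_pos
  have hkq := D.k_lt_q
  obtain ⟨c, hc, hlow⟩ := pohozaev_lower hA
  obtain ⟨M, hM, hup⟩ := pohozaev_upper hA
  set Y₀ := (D.δ + 1) / D.a * ((2 : ℝ) ^ D.δ) ^ D.k with hY₀
  set s := (D.k + 1) * (D.q + 1) - (D.δ + 1) * (D.q - D.k) with hs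
  have hs0 : 0 < s := sub_pos.2 D.subcritical
  have key : ∀ t : ℝ, 1 ≤ t → t ^ s ≤ Y₀ ^ (D.k + 1 : ℝ) / (c / M) ^ (D.q - D.k) := by
    intro t ht1
    have ht : 0 < t := by linarith
    have hmem : t ∈ D.life 0 := by rw [life_zero]; exact ht.le
    have hφ := phi_pos hA hmem
    set p := D.phi 0 t with hp
    have hX : c / M ≤ t ^ (D.δ + 1) * p ^ (D.k + 1) / t ^ (D.k + 1) := by
      rw [div_le_iff₀' hM]
      exact (hlow t ht1).trans (hup t ht)
    have hY : t ^ (D.k + 1) * p ^ (D.q - D.k) ≤ Y₀ := by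
      have h1 := phi_decay hA ht
      rw [div_mul_eq_mul_div, div_le_iff₀ (by linarith)] at h1
      rw [hY₀, div_mul_eq_mul_div, le_div_iff₀ ha]
      linarith
    have eX : t ^ (D.δ + 1) * p ^ (D.k + 1) / t ^ (D.k + 1)
        = t ^ (D.δ + 1 - (D.k + 1)) * p ^ (D.k + 1 : ℝ) := by
      rw [Real.rpow_sub ht]
      norm_cast
      ring
    have eY : t ^ (D.k + 1) * p ^ (D.q - D.k) = t ^ (D.k + 1 : ℝ) * p ^ (D.q - D.k) := by
      norm_cast
    rw [eX] at hX
    rw [eY] at hY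
    have h1 := Real.rpow_le_rpow (by positivity) hX (sub_nonneg.2 hkq.le)
    have h2 := Real.rpow_le_rpow (by positivity) hY (by linarith : (0 : ℝ) ≤ D.k + 1)
    rw [Real.mul_rpow (by positivity) (by positivity), ← Real.rpow_mul ht.le,
      ← Real.rpow_mul hφ.le] at h1 h2
    rw [le_div_iff₀ (by positivity)]
    calc t ^ s * (c / M) ^ (D.q - D.k)
        ≤ t ^ s * (t ^ ((D.δ + 1 - (D.k + 1)) * (D.q - D.k))
          * p ^ ((D.k + 1) * (D.q - D.k))) := by gcongr
      _ = t ^ ((D.k + 1 : ℝ) * (D.k + 1)) * p ^ ((D.q - D.k) * (D.k + 1)) := by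
          rw [← mul_assoc, ← Real.rpow_add ht, mul_comm (D.q - D.k)]
          congr 2
          rw [hs]
          ring
      _ ≤ _ := h2
  obtain ⟨t, ht, ht'⟩ := ((tendsto_rpow_atTop hs0).eventually_gt_atTop
    (Y₀ ^ (D.k + 1 : ℝ) / (c / M) ^ (D.q - D.k))).and (eventually_ge_atTop 1) |>.exists
  exact absurd (key t ht') (not_le.2 ht)

/-- Between the crossing and the trapped parameters there is one that is neither. -/
lemma exists_critical : ∃ ε, 0 < ε ∧ ¬D.Crosses ε ∧ ¬D.Trapped ε := by
  obtain ⟨ε₁, hε₁, hB⟩ := exists_trapped (D := D)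
  by_contra! hall
  have hsub : Icc 0 ε₁ ⊆ {ε | D.Crosses ε} ∪ {ε | D.Trapped ε} := fun ε hε => by
    rcases hε.1.eq_or_lt with rfl | h
    · exact Or.inl crosses_zero
    · by_cases hc : D.Crosses ε
      · exact Or.inl hc
      · exact Or.inr (hall ε h hc)
  obtain ⟨ε, hε, h1, h2⟩ := isPreconnected_Icc _ _ isOpen_crosses isOpen_trapped hsub
    ⟨0, ⟨le_rfl, hε₁⟩, crosses_zero⟩ ⟨ε₁, ⟨hε₁, le_rfl⟩, hB⟩
  exact not_crosses_and_trapped hε.1 h1 h2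

/-! ### The critical profile -/

/-- A profile that does not cross descends to zero. On a half line this holds because the barrier
gives `v ≥ c / t` for as long as `φ ≥ η`; on a finite life time because degeneration is excluded
by the barrier. -/
lemma exists_phi_lt {ε η : ℝ} (hε : 0 < ε) (hA : ¬D.Crosses ε) (hη : 0 < η) :
    ∃ t ∈ D.life ε, D.phi ε t < η := by
  by_contra! hge
  have hδ := D.δ_pos
  have hb := D.b_pos
  set G := D.react ε η with hG
  have hG0 : 0 < G := D.react_pos hε.le hη
  rcases life_eq (D := D) hε.le with hl | ⟨S, hS, hl⟩
  · have hmem : ∀ s : ℝ, 0 ≤ s → s ∈ D.life ε := fun s hs => by rw [hl]; exact hs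
    set c := min 1 (G / (2 * (ε * D.b + (D.δ + 1)))) with hc
    have hc0 : 0 < c := lt_min one_pos (by positivity)
    have hc1 : c ≤ 1 := min_le_left _ _
    have hcG : (ε * D.b + (D.δ + 1)) * c < G := by
      have h1 : c ≤ G / (2 * (ε * D.b + (D.δ + 1))) := min_le_right _ _
      rw [le_div_iff₀ (by positivity)] at h1
      linarith
    have hck : c ^ D.k ≤ c := pow_le_of_le_one hc0.le hc1 D.k_ne_zero
    have hv : ∀ T, 1 ≤ T → c / T ≤ D.speed ε T := fun T hT => by
      have hT0 : 0 < T := by linarith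
      have e : T * (c ^ D.k / T ^ (D.k + 1)) = (c / T) ^ D.k := by
        rw [div_pow, pow_succ]
        field_simp
      have hm : 0 < c ^ D.k / T ^ (D.k + 1) := by positivity
      have h1 := prof_barrier hε.le (hmem T hT0.le) hm (hge T (hmem T hT0.le)) (by
        rw [e, D.rt_of_pow (by positivity)]
        have h2 : c ^ D.k / T ^ (D.k + 1) ≤ c :=
          (div_le_self (by positivity) (one_le_pow₀ hT)).trans hck
        have h3 : ε * D.b * T * (c / T) = ε * D.b * c := by field_simp
        rw [h3]
        nlinarith) T ⟨hT0.le, le_rfl⟩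
      rw [← D.rt_of_pow (by positivity : 0 ≤ c / T), ← e]
      exact D.rt_mono (mul_le_mul_of_nonneg_left h1 hT0.le)
    have hd : ∀ t ∈ Ici (1 : ℝ), HasDerivAt (fun t => D.phi ε t + c * Real.log t)
        (-D.speed ε t + c * t⁻¹) t := fun t ht => by
      have ht0 : (0 : ℝ) < t := one_pos.trans_le ht
      exact (hasDerivAt_phi (hmem t ht0.le) ht0).add ((Real.hasDerivAt_log ht0.ne').const_mul c)
    have hanti := antitoneOn_of_deriv_nonpos (convex_Ici 1)
      (fun t ht => (hd t ht).continuousAt.continuousWithinAt)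
      (fun t ht => (hd t (interior_subset ht)).differentiableAt.differentiableWithinAt)
      (fun t ht => by
        have ht := interior_subset ht
        rw [(hd t ht).deriv]
        have := hv t ht
        rw [div_eq_mul_inv] at this
        linarith)
    obtain ⟨t, ht, ht1⟩ := ((Real.tendsto_log_atTop.eventually_gt_atTop
      (D.phi ε 1 / c)).and (eventually_ge_atTop 1)).exists
    have h1 : D.phi ε t + c * Real.log t ≤ D.phi ε 1 + c * Real.log 1 := hanti self_mem_Ici ht1 ht1
    rw [Real.log_one, mul_zero, add_zero] at h1
    rw [div_lt_iff₀' hc0] at ht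
    have := phi_pos hA (hmem t (by linarith))
    linarith
  · obtain ⟨m, hmlt, hm⟩ : ∃ m, ε * D.b * S * D.rt (S * m) + (D.δ + 1) * m < G ∧ 0 < m := by
      have hc : Continuous fun m => ε * D.b * S * D.rt (S * m) + (D.δ + 1) * m := by
        have := D.continuous_rt
        fun_prop
      have h0 : ε * D.b * S * D.rt (S * 0) + (D.δ + 1) * 0 < G := by
        rw [mul_zero, D.rt_of_nonpos le_rfl]
        simpa using hG0
      have h1 := (hc.tendsto 0).eventually (gt_mem_nhds h0)
      exact ((h1.filter_mono nhdsWithin_le_nhds).and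
        (self_mem_nhdsWithin : ∀ᶠ m in 𝓝[>] (0 : ℝ), m ∈ Ioi 0)).exists
    obtain ⟨t, ht, hlt⟩ := not_bounded_below hS hl hm
    refine absurd hlt (not_lt.2 (prof_barrier hε.le ht hm (hge t ht) ?_ t ⟨ht.1, le_rfl⟩))
    have htS : t ≤ S := by rw [hl] at ht; exact ht.2.le
    have h2 : ε * D.b * t * D.rt (t * m) ≤ ε * D.b * S * D.rt (S * m) := by
      have h3 : D.rt (t * m) ≤ D.rt (S * m) := D.rt_mono (by gcongr)
      have := D.rt_nonneg (t * m)
      have := ht.1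
      gcongr
    linarith

/-- At a critical parameter the reverse of the trapping inequality holds eventually. -/
lemma exists_le_speed_pow {ε : ℝ} (hε : 0 < ε) (hA : ¬D.Crosses ε) (hB : ¬D.Trapped ε) :
    ∃ t₀ ∈ D.life ε, ∀ t ∈ D.life ε, t₀ ≤ t → ε * D.b * t * D.phi ε t ≤ D.speed ε t ^ D.k := by
  have hq := D.one_lt_q
  have ha := D.a_pos
  have hgap : 0 < ε * (D.b * (D.δ + 1) - D.κ) := mul_pos hε (by linarith [D.κ_lt])
  have hc : Continuous fun x : ℝ => D.a * x ^ (D.q - 1) :=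
    continuous_const.mul (continuous_id.rpow_const fun _ => Or.inr (by linarith))
  have h0 : D.a * (0 : ℝ) ^ (D.q - 1) < ε * (D.b * (D.δ + 1) - D.κ) := by
    rwa [Real.zero_rpow (by linarith), mul_zero]
  obtain ⟨η, hlt, hη⟩ := (((hc.tendsto 0).eventually (gt_mem_nhds h0)).filter_mono
    nhdsWithin_le_nhds |>.and (self_mem_nhdsWithin : ∀ᶠ m in 𝓝[>] (0 : ℝ), m ∈ Ioi 0)).exists
  obtain ⟨t₀, ht₀, hφ₀⟩ := exists_phi_lt hε hA hη
  refine ⟨t₀, ht₀, fun t ht htt => ?_⟩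
  have hφ := phi_pos hA ht
  have hle : D.phi ε t ≤ η := (phi_le ht ht₀.1 htt).trans hφ₀.le
  have h1 : D.a * D.phi ε t ^ (D.q - 1) < ε * (D.b * (D.δ + 1) - D.κ) :=
    lt_of_le_of_lt (by gcongr) hlt
  have h2 : ε * D.b * D.phi ε t ≤ D.prof ε t := by
    by_contra! hcon
    obtain ⟨h0', h, hs⟩ := id ht
    rw [hs.phi_eqOn ⟨h0', le_rfl⟩] at hcon h1
    rw [hs.prof_eqOn ⟨h0', le_rfl⟩] at hcon
    exact hB ⟨t, h0', h, hs, hcon, h1⟩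
  rw [speed_pow ht]
  calc ε * D.b * t * D.phi ε t = t * (ε * D.b * D.phi ε t) := by ring
    _ ≤ _ := mul_le_mul_of_nonneg_left h2 ht.1

/-- For `k > 1` the critical profile dies in finite time: otherwise `φ^(1-1/k)` would decrease at
least linearly. -/
lemma life_ne_Ici {ε : ℝ} (hk : 1 < D.k) (hε : 0 < ε) (hA : ¬D.Crosses ε) (hB : ¬D.Trapped ε) :
    D.life ε ≠ Ici 0 := by
  intro hl
  have hmem : ∀ s : ℝ, 0 ≤ s → s ∈ D.life ε := fun s hs => by rw [hl]; exact hs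
  have hb := D.b_pos
  have hk0 := D.k_pos
  have hk1 : (1 : ℝ) < D.k := by exact_mod_cast hk
  obtain ⟨t₀, ht₀, hlow⟩ := exists_le_speed_pow hε hA hB
  set t₁ := max t₀ 1
  have hpos : ∀ t, t₁ ≤ t → 0 < t := fun t ht => one_pos.trans_le ((le_max_right _ _).trans ht)
  set p := 1 - (D.k : ℝ)⁻¹ with hp
  have hp0 : 0 < p := sub_pos.2 (inv_lt_one_of_one_lt₀ hk1)
  set c := p * D.rt (ε * D.b) with hc
  have hc0 : 0 < c := mul_pos hp0 (D.rt_pos (by positivity))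
  have hd : ∀ t ∈ Ici t₁, HasDerivAt (fun t => D.phi ε t ^ p + c * t)
      (-D.speed ε t * p * D.phi ε t ^ (p - 1) + c * 1) t := fun t ht =>
    ((hasDerivAt_phi (hmem t (hpos t ht).le) (hpos t ht)).rpow_const
      (Or.inl (phi_pos hA (hmem t (hpos t ht).le)).ne')).add ((hasDerivAt_id t).const_mul c)
  have hanti := antitoneOn_of_deriv_nonpos (convex_Ici t₁)
    (fun t ht => (hd t ht).continuousAt.continuousWithinAt)
    (fun t ht => (hd t (interior_subset ht)).differentiableAt.differentiableWithinAt)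
    (fun t ht => by
      have ht := interior_subset ht
      rw [(hd t ht).deriv]
      have ht0 := hpos t ht
      have hφ := phi_pos hA (hmem t ht0.le)
      have h1 := hlow t (hmem t ht0.le) ((le_max_left _ _).trans ht)
      have h2 : D.rt (ε * D.b) * D.phi ε t ^ (D.k : ℝ)⁻¹ ≤ D.speed ε t := by
        refine le_of_pow_le_pow_left₀ D.k_ne_zero (speed_nonneg _ _) (le_trans ?_ h1)
        rw [mul_pow, D.rt_pow (by positivity), Real.rpow_inv_natCast_pow hφ.le D.k_ne_zero]
        have : 1 ≤ t := (le_max_right _ _).trans ht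
        have h3 : ε * D.b ≤ ε * D.b * t := le_mul_of_one_le_right (by positivity) this
        gcongr
      have h3 : D.phi ε t ^ (p - 1) * D.phi ε t ^ (D.k : ℝ)⁻¹ = 1 := by
        rw [← Real.rpow_add hφ, hp]
        simp
      have h4 : 0 < D.phi ε t ^ (p - 1) := Real.rpow_pos_of_pos hφ _
      have h5 : c ≤ D.speed ε t * p * D.phi ε t ^ (p - 1) := by
        calc c = p * (D.phi ε t ^ (p - 1) * (D.rt (ε * D.b) * D.phi ε t ^ (D.k : ℝ)⁻¹)) := by
              rw [mul_left_comm (D.phi ε t ^ (p - 1)), h3, mul_one]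
          _ ≤ p * (D.phi ε t ^ (p - 1) * D.speed ε t) := by gcongr
          _ = _ := by ring
      linarith)
  obtain ⟨t, ht, ht1⟩ := ((tendsto_id (α := ℝ)).eventually_gt_atTop
    ((D.phi ε t₁ ^ p + c * t₁) / c) |>.and (eventually_ge_atTop t₁)).exists
  have h1 : D.phi ε t ^ p + c * t ≤ D.phi ε t₁ ^ p + c * t₁ := hanti self_mem_Ici ht1 ht1
  rw [id, div_lt_iff₀' hc0] at ht
  have := Real.rpow_pos_of_pos (phi_pos hA (hmem t (hpos t ht1).le)) p
  linarith

/-- For `k = 1` the critical profile decays faster than every power, since `φ' ≤ -ε b t φ`. -/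
lemma tendsto_rpow_mul_phi {ε p : ℝ} (hk : D.k = 1) (hp : 0 ≤ p) (hε : 0 < ε)
    (hA : ¬D.Crosses ε) (hB : ¬D.Trapped ε) (hl : D.life ε = Ici 0) :
    Tendsto (fun t => t ^ p * D.phi ε t) atTop (𝓝 0) := by
  have hmem : ∀ s : ℝ, 0 ≤ s → s ∈ D.life ε := fun s hs => by rw [hl]; exact hs
  have hb := D.b_pos
  obtain ⟨t₀, ht₀, hlow⟩ := exists_le_speed_pow hε hA hB
  set t₁ := max t₀ (max 1 ((p + 1) / (ε * D.b))) with ht₁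
  have h1t : ∀ t, t₁ ≤ t → 1 ≤ t := fun t ht =>
    ((le_max_left _ _).trans (le_max_right _ _)).trans ht
  have hd : ∀ t ∈ Ici t₁, HasDerivAt (fun t => t ^ (p + 1) * D.phi ε t)
      ((p + 1) * t ^ p * D.phi ε t + t ^ (p + 1) * -D.speed ε t) t := fun t ht => by
    have ht0 : 0 < t := one_pos.trans_le (h1t t ht)
    have h1 := Real.hasDerivAt_rpow_const (x := t) (p := p + 1) (Or.inl ht0.ne')
    rw [add_sub_cancel_right] at h1
    exact h1.mul (hasDerivAt_phi (hmem t ht0.le) ht0)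
  have hanti := antitoneOn_of_deriv_nonpos (convex_Ici t₁)
    (fun t ht => (hd t ht).continuousAt.continuousWithinAt)
    (fun t ht => (hd t (interior_subset ht)).differentiableAt.differentiableWithinAt)
    (fun t ht => by
      have ht := interior_subset ht
      rw [(hd t ht).deriv]
      have ht1 := h1t t ht
      have ht0 : 0 < t := one_pos.trans_le ht1
      have hφ := phi_pos hA (hmem t ht0.le)
      have h1 := hlow t (hmem t ht0.le) ((le_max_left _ _).trans ht)
      rw [hk, pow_one] at h1
      have h2 : (p + 1) / (ε * D.b) ≤ t := ((le_max_right _ _).trans (le_max_right _ _)).trans ht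
      rw [div_le_iff₀ (by positivity)] at h2
      have h3 : p + 1 ≤ ε * D.b * t * t := by nlinarith [mul_pos hε hb]
      have h4 : (0 : ℝ) < t ^ p := Real.rpow_pos_of_pos ht0 p
      rw [Real.rpow_add_one ht0.ne']
      calc _ ≤ (ε * D.b * t * t) * t ^ p * D.phi ε t
            + t ^ p * t * -(ε * D.b * t * D.phi ε t) := by gcongr
        _ = 0 := by ring)
  have hlim : Tendsto (fun t : ℝ => t₁ ^ (p + 1) * D.phi ε t₁ * t⁻¹) atTop (𝓝 0) := by
    simpa using tendsto_inv_atTop_zero.const_mul (t₁ ^ (p + 1) * D.phi ε t₁)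
  refine squeeze_zero' ?_ ?_ hlim
  · filter_upwards [eventually_ge_atTop t₁] with t ht
    have ht0 : 0 < t := one_pos.trans_le (h1t t ht)
    have := phi_pos hA (hmem t ht0.le)
    positivity
  · filter_upwards [eventually_ge_atTop t₁] with t ht
    have ht0 : 0 < t := one_pos.trans_le (h1t t ht)
    have h1 : t ^ (p + 1) * D.phi ε t ≤ t₁ ^ (p + 1) * D.phi ε t₁ := hanti self_mem_Ici ht ht
    rw [Real.rpow_add_one ht0.ne'] at h1
    rw [← div_eq_mul_inv, le_div_iff₀ ht0]
    linarith

/-- At a finite end of the life time the speed tends to zero: the flux `t^δ v^k` has a bounded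
growth rate and takes arbitrarily small values near the end. -/
lemma tendsto_speed {ε S : ℝ} (hε : 0 ≤ ε) (hS : 0 < S) (hl : D.life ε = Ico 0 S) :
    Tendsto (D.speed ε) (𝓝[<] S) (𝓝 0) := by
  have hδ := D.δ_pos
  have hκ := D.κ_pos
  have ha := D.a_pos
  have hb := D.b_pos
  set C := S ^ D.δ * (ε * D.κ + D.a) with hC
  have hSδ : 0 < S ^ D.δ := Real.rpow_pos_of_pos hS _
  have hC0 : 0 ≤ C := by positivity
  have hgrow : ∀ s t, 0 < s → s ≤ t → t < S →
      t ^ D.δ * D.speed ε t ^ D.k ≤ s ^ D.δ * D.speed ε s ^ D.k + C * (t - s) := by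
    intro s t hs hst ht
    have hd : ∀ x ∈ Icc s t, HasDerivAt (fun t => t ^ D.δ * D.speed ε t ^ D.k - C * t)
        (x ^ D.δ * D.src ε (D.speed ε) x - C * 1) x := fun x hx =>
      (hasDerivAt_flux (by rw [hl]; exact ⟨hs.le.trans hx.1, hx.2.trans_lt ht⟩)
        (hs.trans_le hx.1)).sub ((hasDerivAt_id x).const_mul C)
    have hanti := antitoneOn_of_deriv_nonpos (convex_Icc s t)
      (fun x hx => (hd x hx).continuousAt.continuousWithinAt)
      (fun x hx => (hd x (interior_subset hx)).differentiableAt.differentiableWithinAt)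
      (fun x hx => by
        have hx := interior_subset hx
        rw [(hd x hx).deriv]
        have hx0 := hs.trans_le hx.1
        have h1 : x ^ D.δ ≤ S ^ D.δ := Real.rpow_le_rpow hx0.le (hx.2.trans ht.le) hδ.le
        have h2 : D.src ε (D.speed ε) x ≤ ε * D.κ + D.a := by
          have := D.react_le hε (height (D.speed ε) x)
          have : 0 ≤ ε * D.b * x * D.speed ε x := mul_nonneg (by positivity) (speed_nonneg _ _)
          rw [src]
          linarith
        have h3 : 0 ≤ x ^ D.δ := Real.rpow_nonneg hx0.le _
        have h4 : x ^ D.δ * D.src ε (D.speed ε) x ≤ S ^ D.δ * (ε * D.κ + D.a) :=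
          (mul_le_mul_of_nonneg_left h2 h3).trans (by gcongr)
        linarith)
    have h : t ^ D.δ * D.speed ε t ^ D.k - C * t ≤ s ^ D.δ * D.speed ε s ^ D.k - C * s :=
      hanti ⟨le_rfl, hst⟩ ⟨hst, le_rfl⟩ hst
    linarith
  have hflux : Tendsto (fun t => t ^ D.δ * D.speed ε t ^ D.k) (𝓝[<] S) (𝓝 0) := by
    have hA0 : 0 < S ^ D.δ * S + C := by positivity
    rw [Metric.tendsto_nhds]
    intro r hr
    set η := r / (2 * (S ^ D.δ * S + C)) with hη
    have hη0 : 0 < η := by positivity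
    have hmem : max (S - η) (S / 2) ∈ D.life ε := by
      rw [hl]
      exact ⟨le_max_of_le_right (by linarith), max_lt (by linarith) (by linarith)⟩
    obtain ⟨m, hm, hlow⟩ := exists_lower_prof hmem
    obtain ⟨s, hs, hlt⟩ := not_bounded_below hS hl (lt_min hm hη0)
    have hs1 : max (S - η) (S / 2) < s := by
      by_contra! hcon
      exact absurd (hlow s ⟨hs.1, hcon⟩) (not_lt.2 (hlt.trans_le (min_le_left _ _)).le)
    have hsS : s < S := by rw [hl] at hs; exact hs.2
    have hs0 : 0 < s := by
      have := (le_max_right _ _).trans_lt hs1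
      linarith
    have hsη : S - η < s := (le_max_left _ _).trans_lt hs1
    filter_upwards [Ioo_mem_nhdsLT hsS] with t ht
    have h1 := hgrow s t hs0 ht.1.le ht.2
    have h2 : s ^ D.δ * D.speed ε s ^ D.k ≤ S ^ D.δ * (S * η) := by
      rw [speed_pow hs]
      have := (hlt.trans_le (min_le_right _ _)).le
      have := (prof_pos hs).le
      gcongr
    have h3 : C * (t - s) ≤ C * η := by
      have := ht.2
      gcongr
      linarith
    have h4 : 0 ≤ t ^ D.δ * D.speed ε t ^ D.k :=
      mul_nonneg (Real.rpow_nonneg (hs0.trans ht.1).le _) (pow_nonneg (speed_nonneg _ _) _)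
    rw [Real.dist_eq, sub_zero, abs_of_nonneg h4]
    have h5 : (S ^ D.δ * S + C) * η = r / 2 := by rw [hη]; field_simp
    nlinarith
  have hlim : Tendsto (fun t => D.rt (t ^ D.δ * D.speed ε t ^ D.k / t ^ D.δ)) (𝓝[<] S) (𝓝 0) := by
    have h1 : Tendsto (fun t : ℝ => t ^ D.δ) (𝓝[<] S) (𝓝 (S ^ D.δ)) :=
      (D.continuous_rpow_δ.tendsto S).mono_left nhdsWithin_le_nhds
    have h2 := (D.continuous_rt.tendsto _).comp (hflux.div h1 hSδ.ne')
    rwa [zero_div, D.rt_of_nonpos le_rfl] at h2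
  refine hlim.congr' ?_
  filter_upwards [Ioo_mem_nhdsLT hS] with t ht
  rw [mul_div_cancel_left₀ _ (Real.rpow_pos_of_pos ht.1 _).ne', D.rt_of_pow (speed_nonneg _ _)]

/-- The speed of the maximal profile, extended by zero, is continuous on the line. -/
lemma continuous_speed {ε : ℝ} (hε : 0 ≤ ε) : Continuous (D.speed ε) := by
  rw [continuous_iff_continuousAt]
  intro t
  have hneg : ∀ s < 0, D.speed ε s = 0 := fun s hs => speed_of_notMem fun h => not_le.2 hs h.1
  rcases lt_trichotomy t 0 with ht | rfl | ht
  · exact (continuousAt_const (y := (0 : ℝ))).congr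
      (by filter_upwards [gt_mem_nhds ht] with s hs using (hneg s hs).symm)
  · obtain ⟨T, hT, -, h, hs⟩ := exists_gt_mem_life (zero_mem_life (D := D) hε)
    refine (D.continuous_vel hs.cont).continuousAt.congr ?_
    have h0 : 0 < h 0 := hs.pos 0 ⟨le_rfl, hT.le⟩
    filter_upwards [hs.cont.continuousAt.eventually (lt_mem_nhds h0), gt_mem_nhds hT] with s h1 h2
    rcases lt_or_ge s 0 with h3 | h3
    · rw [hneg s h3, vel, D.rt_of_nonpos (mul_nonpos_of_nonpos_of_nonneg h3.le h1.le)]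
    · exact (hs.speed_eqOn ⟨h3, h2.le⟩).symm
  · by_cases hmem : t ∈ D.life ε
    · exact continuousAt_speed hmem ht
    rcases life_eq (D := D) hε with hl | ⟨S, hS, hl⟩
    · exact absurd (by rw [hl]; exact ht.le) hmem
    have hSt : S ≤ t := by
      by_contra! hcon
      exact hmem (by rw [hl]; exact ⟨ht.le, hcon⟩)
    have hz : ∀ s, S ≤ s → D.speed ε s = 0 := fun s hs =>
      speed_of_notMem (by rw [hl]; exact fun h => not_lt.2 hs h.2)
    rcases hSt.eq_or_lt with rfl | hlt
    · rw [continuousAt_iff_continuous_left'_right']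
      simp only [ContinuousWithinAt, hz S le_rfl]
      exact ⟨tendsto_speed hε hS hl, tendsto_const_nhds.congr' (by
        filter_upwards [self_mem_nhdsWithin] with s hs using (hz s (le_of_lt hs)).symm)⟩
    · exact (continuousAt_const (y := (0 : ℝ))).congr
        (by filter_upwards [lt_mem_nhds hlt] with s hs using (hz s hs.le).symm)

lemma phi_antitone {ε : ℝ} (hε : 0 ≤ ε) : Antitone (D.phi ε) :=
  height_antitone (continuous_speed hε) fun t => speed_nonneg ε t

lemma continuous_phi {ε : ℝ} (hε : 0 ≤ ε) : Continuous (D.phi ε) :=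
  continuous_height (continuous_speed hε)

lemma phi_of_ge {ε S : ℝ} (hε : 0 < ε) (hA : ¬D.Crosses ε) (hl : D.life ε = Ico 0 S)
    (hS : 0 < S) {t : ℝ} (ht : S ≤ t) : D.phi ε t = 0 := by
  have h1 : D.phi ε S = 0 := by
    refine le_antisymm (le_of_forall_pos_le_add fun η hη => ?_) ?_
    · obtain ⟨s, hs, hlt⟩ := exists_phi_lt hε hA hη
      have hsS : s ≤ S := by rw [hl] at hs; exact hs.2.le
      rw [zero_add]
      exact (phi_antitone hε.le hsS).trans hlt.le
    · have : S ∈ closure (Ico 0 S) := by rw [closure_Ico hS.ne]; exact ⟨hS.le, le_rfl⟩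
      exact le_on_closure (f := fun _ => (0 : ℝ)) (g := D.phi ε) (s := Ico 0 S)
        (fun s hs => (phi_pos hA (by rw [hl]; exact hs)).le) continuousOn_const
        (continuous_phi hε.le).continuousOn this
  have cv := continuous_speed (D := D) hε.le
  have h2 : ∫ τ in S..t, D.speed ε τ = 0 := by
    rw [intervalIntegral.integral_congr (g := fun _ => (0 : ℝ))]
    · simp
    · intro τ hτ
      rw [uIcc_of_le ht] at hτ
      exact speed_of_notMem (by rw [hl]; exact fun h => not_lt.2 hτ.1 h.2)
  have h3 := intervalIntegral.integral_add_adjacent_intervals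
    (cv.intervalIntegrable 0 S) (cv.intervalIntegrable (μ := MeasureTheory.volume) S t)
  simp only [phi, height] at h1 ⊢
  linarith

lemma phi_nonneg {ε : ℝ} (hε : 0 < ε) (hA : ¬D.Crosses ε) {t : ℝ} (ht : 0 ≤ t) :
    0 ≤ D.phi ε t := by
  rcases life_eq (D := D) hε.le with hl | ⟨S, hS, hl⟩
  · exact (phi_pos hA (by rw [hl]; exact ht)).le
  · rcases lt_or_ge t S with h | h
    · exact (phi_pos hA (by rw [hl]; exact ⟨ht, h⟩)).le
    · exact (phi_of_ge hε hA hl hS h).ge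

/-- The integrated equation for the critical profile extended by zero. -/
lemma flux_eq {ε : ℝ} (hε : 0 < ε) (hA : ¬D.Crosses ε) {t : ℝ} (ht : 0 ≤ t) :
    t ^ D.δ * D.speed ε t ^ D.k = D.prim (D.src ε (D.speed ε)) t := by
  rcases life_eq (D := D) hε.le with hl | ⟨S, hS, hl⟩
  · exact flux_eq_prim (by rw [hl]; exact ht)
  have cv := continuous_speed (D := D) hε.le
  have csrc := D.continuous_src ε cv
  have cprim : Continuous (D.prim (D.src ε (D.speed ε))) :=
    continuous_iff_continuousAt.2 fun t => (D.hasDerivAt_prim csrc t).continuousAt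
  have cflux : Continuous fun t => t ^ D.δ * D.speed ε t ^ D.k :=
    D.continuous_rpow_δ.mul (cv.pow _)
  have heq : EqOn (fun t => t ^ D.δ * D.speed ε t ^ D.k) (D.prim (D.src ε (D.speed ε)))
      (Ico 0 S) := fun t ht => flux_eq_prim (by rw [hl]; exact ht)
  have heq' := heq.closure cflux cprim
  rw [closure_Ico hS.ne] at heq'
  rcases le_or_gt t S with h | h
  · exact heq' ⟨ht, h⟩
  have hz : ∀ s, S ≤ s → D.speed ε s = 0 := fun s hs =>
    speed_of_notMem (by rw [hl]; exact fun h => not_lt.2 hs h.2)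
  have hS0 : D.prim (D.src ε (D.speed ε)) S = 0 := by
    rw [← heq' ⟨hS.le, le_rfl⟩]
    simp only [hz S le_rfl, zero_pow D.k_ne_zero, mul_zero]
  have h2 : ∫ τ in S..t, τ ^ D.δ * D.src ε (D.speed ε) τ = 0 := by
    rw [intervalIntegral.integral_congr (g := fun _ => (0 : ℝ))]
    · simp
    · intro τ hτ
      rw [uIcc_of_le h.le] at hτ
      have h3 : height (D.speed ε) τ = 0 := phi_of_ge hε hA hl hS hτ.1
      simp only [src, h3, hz τ hτ.1, D.react_of_mem le_rfl zero_le_one]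
      rw [Real.zero_rpow (by linarith [D.one_lt_q])]
      ring
  have cint : Continuous fun τ => τ ^ D.δ * D.src ε (D.speed ε) τ := D.continuous_rpow_δ.mul csrc
  have h3 := intervalIntegral.integral_add_adjacent_intervals
    (cint.intervalIntegrable 0 S) (cint.intervalIntegrable (μ := MeasureTheory.volume) S t)
  rw [hz t h.le, zero_pow D.k_ne_zero, mul_zero]
  simp only [prim] at hS0 ⊢
  linarith

/-! ### Classical solutions of the rescaled family -/

variable (D) in
/-- Classical solutions with initial height `γ` of the equation with parameter `ε`; the case
`ε = 1` is `IsSolution`. -/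
structure IsProfile (ε γ : ℝ) (θ : ℝ → ℝ) : Prop where
  contDiffOn : ContDiffOn ℝ 1 θ (Ici 0)
  ode : ∀ s : ℝ, 0 < s →
    HasDerivAt (fun t : ℝ => t ^ D.δ * (deriv θ t) ^ D.k)
      (-(s ^ D.δ * (ε * (D.b * s * deriv θ s + D.κ * θ s) + D.a * (|θ s| ^ (D.q - 1) * θ s)))) s
  init_value : θ 0 = γ
  init_deriv : derivWithin θ (Ici 0) 0 = 0

lemma abs_rpow_mul_self {x : ℝ} (hx : 0 ≤ x) : |x| ^ (D.q - 1) * x = x ^ D.q := by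
  have := D.one_lt_q
  rw [abs_of_nonneg hx, ← Real.rpow_add_one' hx (by linarith), sub_add_cancel]

lemma isProfile_phi {ε : ℝ} (hε : 0 < ε) (hA : ¬D.Crosses ε) : D.IsProfile ε 1 (D.phi ε) := by
  have cv := continuous_speed (D := D) hε.le
  have hd : ∀ t, HasDerivAt (D.phi ε) (-D.speed ε t) t := hasDerivAt_height cv
  have hderiv : deriv (D.phi ε) = fun t => -D.speed ε t := funext fun t => (hd t).deriv
  refine ⟨ContDiff.contDiffOn ?_, fun s hs => ?_, phi_zero ε, ?_⟩
  · rw [contDiff_one_iff_deriv, hderiv]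
    exact ⟨fun t => (hd t).differentiableAt, cv.neg⟩
  · simp only [hderiv]
    have h1 := (D.hasDerivAt_prim (D.continuous_src ε cv) s).neg
    refine (h1.congr_deriv ?_).congr_of_eventuallyEq ?_
    · have h0 : 0 ≤ height (D.speed ε) s := phi_nonneg hε hA hs.le
      have h1 : height (D.speed ε) s ≤ 1 := by
        have := phi_antitone (D := D) hε.le hs.le
        rwa [phi_zero] at this
      rw [src, D.react_of_mem h0 h1, phi, abs_rpow_mul_self h0]
      ring
    · filter_upwards [lt_mem_nhds hs] with t ht
      rw [D.k_odd.neg_pow, mul_neg, flux_eq hε hA (le_of_lt ht), Pi.neg_apply]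
  · rw [(hd 0).hasDerivWithinAt.derivWithin (uniqueDiffOn_Ici 0 0 self_mem_Ici), speed, vel,
      zero_mul, D.rt_of_nonpos le_rfl, neg_zero]

section Uniqueness

variable {ε : ℝ} {ψ : ℝ → ℝ}

/-- The derivative of a profile, extended to the line as a continuous function. -/
noncomputable def slope (ψ : ℝ → ℝ) (t : ℝ) : ℝ := derivWithin ψ (Ici 0) (max t 0)

variable (D) in
/-- The bracket of the equation, extended to the line as a continuous function. -/
noncomputable def force (ε : ℝ) (ψ : ℝ → ℝ) (t : ℝ) : ℝ :=
  ε * (D.b * t * slope ψ t + D.κ * ψ (max t 0)) + D.a * (|ψ (max t 0)| ^ (D.q - 1) * ψ (max t 0))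

lemma IsProfile.continuous_ext {γ : ℝ} (hψ : D.IsProfile ε γ ψ) :
    Continuous fun t => ψ (max t 0) :=
  hψ.contDiffOn.continuousOn.comp_continuous (by fun_prop) fun t => le_max_right t 0

lemma IsProfile.continuous_slope {γ : ℝ} (hψ : D.IsProfile ε γ ψ) : Continuous (slope ψ) :=
  ((contDiffOn_one_iff_derivWithin (uniqueDiffOn_Ici 0)).1 hψ.contDiffOn).2.comp_continuous
    (by fun_prop) fun t => le_max_right t 0

lemma deriv_eq_slope {t : ℝ} (ht : 0 < t) : deriv ψ t = slope ψ t := by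
  rw [slope, max_eq_left ht.le, derivWithin_of_mem_nhds (Ici_mem_nhds ht)]

lemma IsProfile.hasDerivAt {γ : ℝ} (hψ : D.IsProfile ε γ ψ) {t : ℝ} (ht : 0 < t) :
    HasDerivAt ψ (slope ψ t) t := by
  rw [← deriv_eq_slope ht]
  exact ((hψ.contDiffOn.differentiableOn one_ne_zero).differentiableAt
    (Ici_mem_nhds ht)).hasDerivAt

lemma IsProfile.slope_zero {γ : ℝ} (hψ : D.IsProfile ε γ ψ) : slope ψ 0 = 0 := by
  rw [slope, max_self, hψ.init_deriv]

lemma IsProfile.continuous_force {γ : ℝ} (hψ : D.IsProfile ε γ ψ) :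
    Continuous (D.force ε ψ) := by
  have h1 := hψ.continuous_slope
  have h2 := hψ.continuous_ext
  have h3 : Continuous fun t => |ψ (max t 0)| ^ (D.q - 1) :=
    h2.abs.rpow_const fun _ => Or.inr (by linarith [D.one_lt_q])
  exact (continuous_const.mul (((continuous_const.mul continuous_id).mul h1).add
    (continuous_const.mul h2))).add (continuous_const.mul (h3.mul h2))

lemma IsProfile.hasDerivAt_flux {γ : ℝ} (hψ : D.IsProfile ε γ ψ) {t : ℝ} (ht : 0 < t) :
    HasDerivAt (fun s => s ^ D.δ * slope ψ s ^ D.k) (-(t ^ D.δ * D.force ε ψ t)) t := by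
  have h := hψ.ode t ht
  rw [deriv_eq_slope ht] at h
  rw [force, max_eq_left ht.le]
  refine h.congr_of_eventuallyEq ?_
  filter_upwards [lt_mem_nhds ht] with s hs
  rw [deriv_eq_slope hs]

lemma IsProfile.flux_eq {γ : ℝ} (hψ : D.IsProfile ε γ ψ) {t : ℝ} (ht : 0 ≤ t) :
    t ^ D.δ * slope ψ t ^ D.k = -D.prim (D.force ε ψ) t := by
  have h1 := intervalIntegral.integral_eq_sub_of_hasDerivAt_of_le ht
    (D.continuous_rpow_δ.mul (hψ.continuous_slope.pow D.k)).continuousOn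
    (fun s hs => hψ.hasDerivAt_flux hs.1)
    ((D.continuous_rpow_δ.mul hψ.continuous_force).neg.intervalIntegrable _ _)
  rw [intervalIntegral.integral_neg] at h1
  simp only [Pi.mul_apply, Pi.pow_apply, hψ.slope_zero, zero_pow D.k_ne_zero, mul_zero,
    sub_zero] at h1
  exact h1.symm

lemma IsProfile.eq_height (hψ : D.IsProfile ε 1 ψ) {t : ℝ} (ht : 0 ≤ t) :
    ψ t = height (fun s => -slope ψ s) t := by
  have h1 := intervalIntegral.integral_eq_sub_of_hasDerivAt_of_le ht
    (hψ.contDiffOn.continuousOn.mono Icc_subset_Ici_self)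
    (fun s hs => hψ.hasDerivAt hs.1) (hψ.continuous_slope.intervalIntegrable _ _)
  rw [height, intervalIntegral.integral_neg, h1, hψ.init_value]
  ring

lemma IsProfile.mul_avg_force {γ : ℝ} (hψ : D.IsProfile ε γ ψ) {t : ℝ} (ht : 0 ≤ t) :
    t * D.avg (D.force ε ψ) t = (-slope ψ t) ^ D.k := by
  rcases ht.eq_or_lt with rfl | h0
  · rw [hψ.slope_zero, neg_zero, zero_pow D.k_ne_zero, zero_mul]
  have h1 := D.rpow_mul_avg (D.force ε ψ) ht
  have h2 := hψ.flux_eq ht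
  rw [rpow_δ_add_one ht] at h1
  refine mul_left_cancel₀ (Real.rpow_pos_of_pos h0 D.δ).ne' ?_
  rw [D.k_odd.neg_pow]
  linarith

lemma IsProfile.neg_slope_eq {γ : ℝ} (hψ : D.IsProfile ε γ ψ) {t : ℝ} (ht : 0 ≤ t)
    (hpos : 0 ≤ D.avg (D.force ε ψ) t) : -slope ψ t = D.vel (D.avg (D.force ε ψ)) t := by
  have h1 : 0 ≤ (-slope ψ t) ^ D.k := by
    rw [← hψ.mul_avg_force ht]
    exact mul_nonneg ht hpos
  rw [vel, hψ.mul_avg_force ht, D.rt_of_pow (D.k_odd.pow_nonneg_iff.1 h1)]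

/-- As long as its height and its unknown `h` are positive, a profile solves the integral
equation. -/
lemma IsProfile.sol (hψ : D.IsProfile ε 1 ψ) {T : ℝ}
    (hpos : ∀ t ∈ Icc 0 T, 0 < D.avg (D.force ε ψ) t ∧ 0 < ψ t) :
    D.Sol ε T (D.avg (D.force ε ψ)) := by
  have ch := D.continuous_avg hψ.continuous_force
  refine ⟨ch, fun t ht => (hpos t ht).1, fun t ht => ?_⟩
  refine D.avg_congr ht.1 fun s hs => ?_
  have hv : EqOn (fun s => -slope ψ s) (D.vel (D.avg (D.force ε ψ))) (Icc 0 T) := fun r hr =>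
    hψ.neg_slope_eq hr.1 (hpos r hr).1.le
  have hsT : s ∈ Icc 0 T := ⟨hs.1, hs.2.trans ht.2⟩
  have h1 : ψ s = height (D.vel (D.avg (D.force ε ψ))) s := by
    rw [hψ.eq_height hs.1]
    exact height_congr hs.1 (hv.mono (Icc_subset_Icc_right hsT.2))
  have h2 := (hpos s hsT).2.le
  have h3 : ψ s ≤ 1 := h1 ▸ height_vel_le_one ch hs.1
  have h4 : -slope ψ s = D.vel (D.avg (D.force ε ψ)) s := hv hsT
  rw [src, ← h1, ← h4, force, max_eq_left hs.1, D.react_of_mem h2 h3, abs_rpow_mul_self h2]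
  ring

/-- On the life time of the maximal positive solution, every profile agrees with it: at a first time
where positivity of the profile failed, it would by continuity agree with the positive solution. -/
lemma IsProfile.eqOn_life (hA : ¬D.Crosses ε) (hψ : D.IsProfile ε 1 ψ) {T : ℝ}
    (hT : T ∈ D.life ε) : ψ T = D.phi ε T ∧ slope ψ T = -D.speed ε T := by
  have hT' := hT
  obtain ⟨hT0, h, hs⟩ := hT
  have ch := D.continuous_avg hψ.continuous_force
  have cψ := hψ.continuous_ext
  have hpos : ∀ t ∈ Icc 0 T, 0 < D.avg (D.force ε ψ) t ∧ 0 < ψ t := by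
    by_contra! hcon
    obtain ⟨t₀, ht₀, hbad⟩ := hcon
    set B := {t | D.avg (D.force ε ψ) t ≤ 0 ∨ ψ (max t 0) ≤ 0} ∩ Icc 0 T with hBdef
    have hB : IsCompact B := isCompact_Icc.inter_left
      ((isClosed_le ch continuous_const).union (isClosed_le cψ continuous_const))
    obtain ⟨t₁, ⟨ht₁, ht₁T⟩, hleast⟩ := hB.exists_isLeast ⟨t₀, by
      refine ⟨?_, ht₀⟩
      by_cases h1 : D.avg (D.force ε ψ) t₀ ≤ 0
      · exact Or.inl h1
      · right
        rw [max_eq_left ht₀.1]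
        exact hbad (not_le.1 h1)⟩
    have hbefore : ∀ t ∈ Ico 0 t₁, 0 < D.avg (D.force ε ψ) t ∧ 0 < ψ t := fun t ht => by
      by_contra hcon
      refine not_le.2 ht.2 (hleast ⟨?_, ht.1, ht.2.le.trans ht₁T.2⟩)
      rw [not_and_or, not_lt, not_lt] at hcon
      rwa [mem_ofPred_eq, max_eq_left ht.1]
    have hsol : ∀ t ∈ Ico 0 t₁, D.Sol ε t (D.avg (D.force ε ψ)) := fun t ht =>
      hψ.sol fun s hs' => hbefore s ⟨hs'.1, hs'.2.trans_lt ht.2⟩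
    have e1 : EqOn (D.avg (D.force ε ψ)) h (Ico 0 t₁) := fun t ht =>
      (hsol t ht).unique (hs.mono (ht.2.le.trans ht₁T.2)) ⟨ht.1, le_rfl⟩
    have e2 : EqOn (fun t => ψ (max t 0)) (height (D.vel h)) (Ico 0 t₁) := fun t ht => by
      simp only [max_eq_left ht.1]
      rw [hψ.eq_height ht.1]
      refine height_congr ht.1 fun s hs' => ?_
      have hs1 : s ∈ Ico 0 t₁ := ⟨hs'.1, hs'.2.trans_lt ht.2⟩
      simp only [hψ.neg_slope_eq hs'.1 (hbefore s hs1).1.le, vel, e1 hs1]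
    have hpos0 : 0 < t₁ := by
      refine lt_of_le_of_ne ht₁T.1 ?_
      rintro rfl
      have hψ0 := hψ.init_value
      rcases ht₁ with h1 | h1
      · have h2 := hs.eq 0 ⟨le_rfl, hT0⟩
        have h3 := hs.pos 0 ⟨le_rfl, hT0⟩
        rw [h2, D.avg_zero] at h3
        rw [D.avg_zero] at h1
        have h4 : D.force ε ψ 0 = D.src ε (D.vel h) 0 := by
          rw [force, src, max_self, height_zero, D.react_of_mem zero_le_one le_rfl, hψ0]
          simp
        rw [h4] at h1
        linarith
      · rw [max_self, hψ0] at h1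
        linarith
    have hcl : t₁ ∈ closure (Ico 0 t₁) := by
      rw [closure_Ico hpos0.ne]
      exact ⟨hpos0.le, le_rfl⟩
    have f1 := e1.closure ch hs.cont hcl
    have f2 : ψ (max t₁ 0) = _ :=
      e2.closure cψ (continuous_height (D.continuous_vel hs.cont)) hcl
    rcases ht₁ with h1 | h1
    · rw [f1] at h1
      exact absurd (hs.pos t₁ ht₁T) (not_lt.2 h1)
    · rw [f2, ← hs.phi_eqOn ht₁T] at h1
      exact absurd (phi_pos hA (mem_life_of_le hT' ht₁T.1 ht₁T.2)) (not_lt.2 h1)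
  have hsol := hψ.sol hpos
  have hv : EqOn (fun s => -slope ψ s) (D.vel (D.avg (D.force ε ψ))) (Icc 0 T) := fun r hr =>
    hψ.neg_slope_eq hr.1 (hpos r hr).1.le
  have hmem : T ∈ Icc 0 T := ⟨hT0, le_rfl⟩
  constructor
  · rw [hsol.phi_eqOn hmem, hψ.eq_height hT0]
    exact height_congr hT0 hv
  · rw [hsol.speed_eqOn hmem, ← hv hmem, neg_neg]

variable (D) in
/-- The energy of a profile, which is nonincreasing because of the damping. -/
noncomputable def energy (ε : ℝ) (ψ : ℝ → ℝ) (t : ℝ) : ℝ :=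
  D.k / (D.k + 1) * slope ψ t ^ (D.k + 1) + ε * D.κ / 2 * ψ t ^ 2
    + D.a / (D.q + 1) * |ψ t| ^ (D.q + 1)

lemma IsProfile.hasDerivAt_energy {γ : ℝ} (hψ : D.IsProfile ε γ ψ) {t : ℝ} (ht : 0 < t) :
    HasDerivAt (D.energy ε ψ)
      (-(D.δ / t * slope ψ t ^ (D.k + 1)) - ε * D.b * t * slope ψ t ^ 2) t := by
  have hk := D.k_pos
  have hq := D.one_lt_q
  have hpt : t ^ D.δ ≠ 0 := (Real.rpow_pos_of_pos ht _).ne'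
  have hv : HasDerivAt (fun s => slope ψ s ^ D.k)
      (-D.force ε ψ t - D.δ / t * slope ψ t ^ D.k) t := by
    have h1 := (hψ.hasDerivAt_flux ht).div
      (Real.hasDerivAt_rpow_const (p := D.δ) (Or.inl ht.ne')) hpt
    refine (h1.congr_deriv ?_).congr_of_eventuallyEq ?_
    · rw [Real.rpow_sub_one ht.ne']
      field_simp
    · filter_upwards [lt_mem_nhds ht] with s hs
      have : s ^ D.δ ≠ 0 := (Real.rpow_pos_of_pos hs _).ne'
      simp only [Pi.div_apply]
      rw [mul_div_cancel_left₀ _ this]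
  have hψ' := hψ.hasDerivAt ht
  have h1 := (((hasDerivAt_pow_succ_of_odd D.k_odd hv).const_mul (D.k / (D.k + 1) : ℝ)).add
    ((hψ'.pow 2).const_mul (ε * D.κ / 2))).add
    (((hasDerivAt_abs_rpow (ψ t) (by linarith : 1 < D.q + 1)).comp t hψ').const_mul
      (D.a / (D.q + 1)))
  refine h1.congr_deriv ?_
  have e : D.q + 1 - 2 = D.q - 1 := by ring
  rw [force, max_eq_left ht.le, e, pow_succ (slope ψ t) D.k]
  have hq1 : D.q + 1 ≠ 0 := by linarith
  field_simp
  push_cast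
  ring

/-- A profile that reaches zero with zero slope stays at zero, by the decay of the energy. -/
lemma IsProfile.eq_zero_of_ge {γ : ℝ} (hε : 0 < ε) (hψ : D.IsProfile ε γ ψ) {S : ℝ} (hS : 0 < S)
    (h0 : ψ S = 0) (h0' : slope ψ S = 0) {t : ℝ} (ht : S ≤ t) : ψ t = 0 := by
  have hk := D.k_pos
  have hq := D.one_lt_q
  have hκ := D.κ_pos
  have ha := D.a_pos
  have hb := D.b_pos
  have hδ := D.δ_pos
  have heven : ∀ s, 0 ≤ slope ψ s ^ (D.k + 1) := fun s => D.k_odd.add_one.pow_nonneg _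
  have hd : ∀ s ∈ Icc S t, HasDerivAt (D.energy ε ψ) _ s := fun s hs =>
    hψ.hasDerivAt_energy (hS.trans_le hs.1)
  have hanti := antitoneOn_of_deriv_nonpos (convex_Icc S t)
    (fun s hs => (hd s hs).continuousAt.continuousWithinAt)
    (fun s hs => (hd s (interior_subset hs)).differentiableAt.differentiableWithinAt)
    (fun s hs => by
      have hs := interior_subset hs
      have hs0 := hS.trans_le hs.1
      rw [(hd s hs).deriv]
      have h1 : 0 ≤ D.δ / s * slope ψ s ^ (D.k + 1) := mul_nonneg (by positivity) (heven s)
      have h2 : 0 ≤ ε * D.b * s * slope ψ s ^ 2 := by positivity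
      linarith)
  have h1 : D.energy ε ψ t ≤ D.energy ε ψ S := hanti ⟨le_rfl, ht⟩ ⟨ht, le_rfl⟩ ht
  have h2 : D.energy ε ψ S = 0 := by
    rw [energy, h0, h0', abs_zero, Real.zero_rpow (by linarith)]
    simp
  rw [h2, energy] at h1
  have h3 : 0 ≤ (D.k : ℝ) / (D.k + 1) * slope ψ t ^ (D.k + 1) :=
    mul_nonneg (by positivity) (heven t)
  have h4 : 0 ≤ D.a / (D.q + 1) * |ψ t| ^ (D.q + 1) := by positivity
  have h5 : ε * D.κ / 2 * ψ t ^ 2 ≤ 0 := by linarith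
  have h6 : ψ t ^ 2 ≤ 0 := nonpos_of_mul_nonpos_right h5 (by positivity)
  exact pow_eq_zero_iff two_ne_zero |>.1 (le_antisymm h6 (sq_nonneg _))

lemma IsProfile.eqOn_phi (hε : 0 < ε) (hA : ¬D.Crosses ε) (hψ : D.IsProfile ε 1 ψ) :
    EqOn ψ (D.phi ε) (Ici 0) := by
  intro t ht
  rcases life_eq (D := D) hε.le with hl | ⟨S, hS, hl⟩
  · exact (hψ.eqOn_life hA (by rw [hl]; exact ht)).1
  rcases lt_or_ge t S with h | h
  · exact (hψ.eqOn_life hA (by rw [hl]; exact ⟨ht, h⟩)).1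
  have hcl : S ∈ closure (Ico 0 S) := by
    rw [closure_Ico hS.ne]
    exact ⟨hS.le, le_rfl⟩
  have e1 : EqOn (fun t => ψ (max t 0)) (D.phi ε) (Ico 0 S) := fun t ht => by
    simp only [max_eq_left ht.1]
    exact (hψ.eqOn_life hA (by rw [hl]; exact ht)).1
  have e2 : EqOn (slope ψ) (fun t => -D.speed ε t) (Ico 0 S) := fun t ht =>
    (hψ.eqOn_life hA (by rw [hl]; exact ht)).2
  have f1 := e1.closure hψ.continuous_ext (continuous_phi hε.le) hcl
  have f2 := e2.closure hψ.continuous_slope (continuous_speed hε.le).neg hcl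
  simp only [max_eq_left hS.le, phi_of_ge hε hA hl hS le_rfl] at f1
  have hmem : S ∉ D.life ε := by rw [hl]; exact fun h => lt_irrefl _ h.2
  simp only [speed_of_notMem hmem, neg_zero] at f2
  rw [phi_of_ge hε hA hl hS h, hψ.eq_zero_of_ge hε hS f1 f2 h]

end Uniqueness

/-- The scaling `θ ↦ c θ(r ·)` with `c^k r^(k+1) = c^q` maps the equation with parameter `ε` to the
one with parameter `ε c^(q-1)`. -/
lemma IsProfile.scale {ε γ c r : ℝ} {θ : ℝ → ℝ} (hθ : D.IsProfile ε γ θ) (hc : 0 < c) (hr : 0 < r)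
    (hcr : c ^ D.k * r ^ (D.k + 1) = c ^ D.q) :
    D.IsProfile (ε * c ^ (D.q - 1)) (c * γ) fun s => c * θ (r * s) := by
  have hd : ∀ s, 0 < s → HasDerivAt (fun s => c * θ (r * s)) (c * (deriv θ (r * s) * r)) s :=
    fun s hs => by
      have h1 : HasDerivAt (fun s : ℝ => r * s) r s := by
        simpa using (hasDerivAt_id s).const_mul r
      have h2 : DifferentiableAt ℝ θ (r * s) :=
        (hθ.contDiffOn.differentiableOn one_ne_zero).differentiableAt
          (Ici_mem_nhds (mul_pos hr hs))
      exact (h2.hasDerivAt.comp s h1).const_mul c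
  have hmaps : MapsTo (fun s : ℝ => r * s) (Ici 0) (Ici 0) := fun s hs => mul_nonneg hr.le hs
  refine ⟨contDiffOn_const.mul (hθ.contDiffOn.comp (by fun_prop) hmaps), fun s hs => ?_, ?_, ?_⟩
  · have hrs := mul_pos hr hs
    have h1 : HasDerivAt (fun s : ℝ => r * s) r s := by
      simpa using (hasDerivAt_id s).const_mul r
    have h2 := ((hθ.ode (r * s) hrs).comp s h1).const_mul (c ^ D.k * r ^ D.k / r ^ D.δ)
    have hrδ : r ^ D.δ ≠ 0 := (Real.rpow_pos_of_pos hr _).ne'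
    refine (h2.congr_deriv ?_).congr_of_eventuallyEq ?_
    · rw [(hd s hs).deriv, Real.mul_rpow hr.le hs.le, abs_mul, abs_of_pos hc,
        Real.mul_rpow hc.le (abs_nonneg _)]
      have e1 : c ^ D.k * r ^ D.k * r = c ^ (D.q - 1) * c := by
        rw [← Real.rpow_add_one hc.ne', sub_add_cancel, ← hcr]
        ring
      set X := |θ (r * s)| ^ (D.q - 1)
      calc _ = -(c ^ D.k * r ^ D.k * r) * (s ^ D.δ * (ε * (D.b * (r * s) * deriv θ (r * s)
            + D.κ * θ (r * s)) + D.a * (X * θ (r * s)))) := by field_simp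
        _ = _ := by rw [e1]; ring
    · filter_upwards [lt_mem_nhds hs] with t ht
      rw [(hd t ht).deriv]
      simp only [Function.comp_apply]
      rw [Real.mul_rpow hr.le (le_of_lt ht), mul_pow, mul_pow]
      field_simp
  · rw [mul_zero, hθ.init_value]
  · have h0 : HasDerivWithinAt θ (derivWithin θ (Ici 0) 0) (Ici 0) (r * 0) := by
      rw [mul_zero]
      exact (hθ.contDiffOn.differentiableOn one_ne_zero 0 self_mem_Ici).hasDerivWithinAt
    have h1 : HasDerivWithinAt (fun s : ℝ => r * s) r (Ici 0) 0 := by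
      simpa using ((hasDerivAt_id (0 : ℝ)).const_mul r).hasDerivWithinAt
    have h2 := (h0.comp 0 h1 hmaps).const_mul c
    rw [hθ.init_deriv] at h2
    have h3 := h2.derivWithin (uniqueDiffOn_Ici 0 0 self_mem_Ici)
    rw [zero_mul, mul_zero] at h3
    exact h3

/-- For a suitable initial height there is a unique profile with parameter `1`; it is nonnegative,
decays faster than any given power, and dies in finite time if `k > 1`. -/
theorem exists_fast_decay (D : Params) {p : ℝ} (hp : 0 ≤ p) :
    ∃ γ, 0 < γ ∧ ∃ θ, D.IsProfile 1 γ θ ∧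
      (∀ ψ, D.IsProfile 1 γ ψ → EqOn ψ θ (Ici 0)) ∧ (∀ s, 0 ≤ s → 0 ≤ θ s) ∧
      Tendsto (fun s => s ^ p * θ s) atTop (𝓝 0) ∧ (1 < D.k → ∃ S, ∀ s, S ≤ s → θ s = 0) := by
  obtain ⟨ε, hε, hA, hB⟩ := exists_critical (D := D)
  have hq := D.one_lt_q
  have hk := D.k_pos
  -- the scaling with `ε γ^(q-1) = 1` and `γ^k r^(k+1) = γ^q`
  set γ := ε ^ (-(D.q - 1)⁻¹) with hγ
  have hγ0 : 0 < γ := Real.rpow_pos_of_pos hε _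
  set r := γ ^ ((D.q - D.k) / (D.k + 1)) with hr
  have hr0 : 0 < r := Real.rpow_pos_of_pos hγ0 _
  have hεγ : ε * γ ^ (D.q - 1) = 1 := by
    rw [hγ, ← Real.rpow_mul hε.le, neg_mul, inv_mul_cancel₀ (by linarith), Real.rpow_neg_one,
      mul_inv_cancel₀ hε.ne']
  have hγr : γ ^ D.k * r ^ (D.k + 1) = γ ^ D.q := by
    rw [hr, ← Real.rpow_mul_natCast hγ0.le, ← Real.rpow_natCast γ, ← Real.rpow_add hγ0]
    congr 1
    push_cast
    field_simp
    ring
  have hγr' : γ⁻¹ ^ D.k * r⁻¹ ^ (D.k + 1) = γ⁻¹ ^ D.q := by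
    rw [inv_pow, inv_pow, Real.inv_rpow hγ0.le, ← hγr, mul_inv]
  have hεγ' : 1 * γ⁻¹ ^ (D.q - 1) = ε := by
    rw [Real.inv_rpow hγ0.le, one_mul]
    exact (eq_inv_of_mul_eq_one_left hεγ).symm
  have hprof := (isProfile_phi hε hA).scale hγ0 hr0 hγr
  rw [hεγ, mul_one] at hprof
  refine ⟨γ, hγ0, _, hprof, fun ψ hψ => ?_, fun s hs => ?_, ?_, fun h1k => ?_⟩
  · have h1 := hψ.scale (inv_pos.2 hγ0) (inv_pos.2 hr0) hγr'
    rw [hεγ', inv_mul_cancel₀ hγ0.ne'] at h1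
    intro s hs
    have h2 := h1.eqOn_phi hε hA (mul_nonneg hr0.le hs : r * s ∈ Ici 0)
    simp only [inv_mul_cancel_left₀ hr0.ne'] at h2
    simp only [← h2, mul_inv_cancel_left₀ hγ0.ne']
  · exact mul_nonneg hγ0.le (phi_nonneg hε hA (mul_nonneg hr0.le hs))
  · rcases life_eq (D := D) hε.le with hl | ⟨S, hS, hl⟩
    · have hk1 : D.k = 1 := by
        by_contra hne
        exact life_ne_Ici (lt_of_le_of_ne (Nat.one_le_iff_ne_zero.2 D.k_ne_zero) (Ne.symm hne))
          hε hA hB hl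
      have h1 := ((tendsto_rpow_mul_phi hk1 hp hε hA hB hl).comp
        (tendsto_id.const_mul_atTop hr0)).const_mul (γ * (r ^ p)⁻¹)
      rw [mul_zero] at h1
      refine h1.congr' ?_
      filter_upwards [eventually_ge_atTop 0] with s hs
      have : r ^ p ≠ 0 := (Real.rpow_pos_of_pos hr0 _).ne'
      simp only [Function.comp_apply, id, Real.mul_rpow hr0.le hs]
      field_simp
    · refine tendsto_const_nhds.congr' ?_
      filter_upwards [eventually_ge_atTop (S / r)] with s hs
      rw [phi_of_ge hε hA hl hS ((div_le_iff₀' hr0).1 hs), mul_zero, mul_zero]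
  · rcases life_eq (D := D) hε.le with hl | ⟨S, hS, hl⟩
    · exact absurd hl (life_ne_Ici h1k hε hA hB)
    · exact ⟨S / r, fun s hs => by
        simp only [phi_of_ge hε hA hl hS ((div_le_iff₀' hr0).1 hs), mul_zero]⟩

end Params

/-! ### The radial `k`-Hessian problem -/

lemma subcritical_of_lt_qStar {n k : ℕ} {q : ℝ} (hk0 : 0 < k) (hkq : (k : ℝ) < q)
    (hq : (q : EReal) < qStar n k) :
    ((n : ℝ) * (k + 1) - 2 * k) / (2 * k) + 1 = (n : ℝ) * (k + 1) / (2 * k) ∧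
      (n : ℝ) * (k + 1) / (2 * k) * (q - k) < (k + 1) * (q + 1) := by
  have hk : (0 : ℝ) < k := by exact_mod_cast hk0
  refine ⟨by field_simp; ring, ?_⟩
  have key : (n : ℝ) * (q - k) < 2 * k * (q + 1) := by
    unfold qStar at hq
    split_ifs at hq with h
    · have h' : (2 : ℝ) * k < n := by exact_mod_cast h
      rw [EReal.coe_lt_coe_iff, lt_div_iff₀ (by linarith)] at hq
      linarith
    · have h' : (n : ℝ) ≤ 2 * k := by exact_mod_cast not_lt.1 h
      nlinarith
  rw [div_mul_eq_mul_div, div_lt_iff₀ (by positivity)]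
  nlinarith

end KHessianProfile

open KHessianProfile in
theorem theorem6p2 (n k : ℕ) (hn : 2 < n) (hk_odd : Odd k) (hkn : k ≤ n)
    (κ q : ℝ) (hκ_pos : 0 < κ) (hκn : κ < n)
    (hkq : (k : ℝ) < q) (hq : (q : EReal) < KHessianProfile.qStar n k) :
    ∃ γ : ℝ, 0 < γ ∧ ∃ θ : ℝ → ℝ,
      -- `θ` is the unique solution `θ(·, γ)` of the initial value problem on `[0,∞)`
      KHessianProfile.IsSolution n k κ q γ θ ∧
      (∀ φ : ℝ → ℝ, KHessianProfile.IsSolution n k κ q γ φ → EqOn φ θ (Ici 0)) ∧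
      (∀ s : ℝ, 0 ≤ s → 0 ≤ θ s) ∧
      Tendsto (fun s : ℝ => s ^ (κ / KHessianProfile.b k) * θ s) atTop (𝓝 0) ∧
      (1 < k → HasCompactSupport ((Ici (0 : ℝ)).domRestrict θ)) := by
  have hk0 : 0 < k := hk_odd.pos
  have hk : (0 : ℝ) < k := by exact_mod_cast hk0
  have hk1 : (1 : ℝ) ≤ k := by exact_mod_cast hk0
  have hn' : (2 : ℝ) < n := by exact_mod_cast hn
  have hkn' : (k : ℝ) ≤ n := by exact_mod_cast hkn
  obtain ⟨hδ, hsub⟩ := subcritical_of_lt_qStar hk0 hkq hq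
  have hc : 0 < c n k :=
    div_pos (by exact_mod_cast Nat.choose_pos hkn) (by linarith)
  have hb : 0 < b k := by unfold b; positivity
  let D : Params :=
    { k := k, δ := δ n k, b := b k, κ := κ, q := q, a := (c n k)⁻¹
      k_odd := hk_odd
      δ_pos := by unfold δ; exact div_pos (by nlinarith) (by positivity)
      b_pos := hb
      κ_pos := hκ_pos
      κ_lt := by
        unfold δ b
        rw [hδ]
        refine hκn.trans_eq ?_
        field_simp
      a_pos := inv_pos.2 hc
      k_lt_q := hkq
      subcritical := by unfold δ; rwa [hδ] }
  have hto : ∀ {γ θ}, IsSolution n k κ q γ θ → D.IsProfile 1 γ θ := fun h =>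
    ⟨h.contDiffOn, fun s hs => by rw [one_mul]; exact h.ode s hs, h.init_value, h.init_deriv⟩
  obtain ⟨γ, hγ, θ, hθ, huniq, hnonneg, hlim, hsupp⟩ :=
    D.exists_fast_decay (p := κ / b k) (by positivity)
  refine ⟨γ, hγ, θ, ⟨hθ.contDiffOn, fun s hs => ?_, hθ.init_value, hθ.init_deriv⟩,
    fun φ hφ => huniq φ (hto hφ), hnonneg, hlim, fun h1k => ?_⟩
  · have := hθ.ode s hs
    rwa [one_mul] at this
  · obtain ⟨S, hS⟩ := hsupp h1k
    refine HasCompactSupport.intro (K := (Subtype.val : Ici (0 : ℝ) → ℝ) ⁻¹' Icc 0 S) ?_ ?_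
    · exact isClosed_Ici.isClosedEmbedding_subtypeVal.isCompact_preimage isCompact_Icc
    · intro x hx
      refine hS x ?_
      by_contra! hlt
      exact hx ⟨x.2, hlt.le⟩
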